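/- **Model.** Data packets are generated by a Poisson process of rate $\lambda>0$ and are sent at once to a single server with a buffer that holds only one packet, the freshest. The packets put in service have i.i.d. exponential service times with parameter $\mu>0$; the server takes vacations whose lengths are i.i.d. with a general law on $[0,\infty)$ that is not concentrated at $0$. Arrivals, service times and vacations are mutually independent. The server leaves for a vacation when it completes a packet; if no packet is in the buffer at the end of a vacation, it takes another one; otherwise it starts to process the packet in the buffer. While the server is on vacation, a new packet replaces the one in the buffer. In the *Conventional Buffer System* (CBS), packets that arrive during a service are rejected. In the *Conventional Buffer System with Preemption in Service* (CBS-P), a packet that arrives during a service preempts and discards the packet in service and its own service starts at once. At time $0$ the system is empty, the server leaves for a vacation, and the age is $0$. Let $C_1<C_2<\dots$ be the completion times of the packets that complete service, let $r_1,r_2,\dots$ be the generation times of these packets, and put $C_0=r_0=0$. The age at time $t\ge 0$ is $\Delta(t)=t-\max\{r_l: C_l\le t\}$, and its $l$-th peak is $A_l=C_l-r_{l-1}$, $l\ge1$. **Theorem.** For both systems the limits $$\bar\Delta=\lim_{\tau\to\infty}\frac1\tau\int_0^\tau\Delta(t)\,dt\quad\text{(the AoI)},\qquad \bar A=\lim_{k\to\infty}\frac1k\sum_{l=1}^{k}A_l=\lim_{l\to\infty}\mathbf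 E[A_l]\quad\text{(the PAoI)}$$ exist in $[0,\infty]$, where the limits of averages exist almost surely and are deterministic, and $$\bar\Delta_{CBS\text{-}P}\le\bar\Delta_{CBS},\qquad \bar A_{CBS\text{-}P}\le\bar A_{CBS}.$$ Moreover, if the limits $\lim_{t\to\infty}\mathbf E[\Delta(t)]$ exist in $[0,\infty]$ for both systems, then the limit for CBS-P is at most the limit for CBS. -/

import Mathlib

open MeasureTheory ProbabilityTheory Filter Topology
open scoped ENNReal

namespace VacationQueue

noncomputable section

/-! ### Sample paths

A sample path of the system is given by the generation (= arrival) times `a 0, a 1, …` of the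
packets, the vacation lengths `v l j` (the `j`-th vacation taken after the `l`-th completion) and
the service times `h l j` (the `j`-th packet put in service between the `l`-th and the `(l+1)`-st
completion). At time `0` the buffer is empty and the server leaves for a vacation, having just
delivered a packet of age zero; this is counted as completion number `0`. -/

/-- Some packet arrives in the time interval `(s, t]`. -/
def ArrivalIn (a : ℕ → ℝ) (s t : ℝ) : Prop :=
  ∃ n, s < a n ∧ a n ≤ t

/-- The time of the last arrival up to (and including) time `t`. -/
def lastArrival (a : ℕ → ℝ) (t : ℝ) : ℝ :=
  sSup {x | ∃ n, x = a n ∧ a n ≤ t}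

/-- The time of the first arrival strictly after time `t`. -/
def nextArrival (a : ℕ → ℝ) (t : ℝ) : ℝ :=
  sInf {x | ∃ n, x = a n ∧ t < a n}

/-- The server leaves at time `t` with an empty buffer and takes vacations of lengths
`v 0, v 1, …`. This is the end of the `j`-th of them. -/
def vacationEnd (v : ℕ → ℝ) (t : ℝ) (j : ℕ) : ℝ :=
  t + ∑ i ∈ Finset.range (j + 1), v i

/-- Multiple vacation scheme: the server resumes work at the first end of a vacation at which it
finds a packet in the buffer, that is, at which a packet has arrived since it left at time `t`. -/
def resumeTime (a v : ℕ → ℝ) (t : ℝ) : ℝ :=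
  vacationEnd v t (sInf {j | ArrivalIn a t (vacationEnd v t j)})

/-- Completion times of the informative packets in the Conventional Buffer System (CBS):
the packet in the buffer when the server resumes work is processed without interruption, packets
that arrive meanwhile are rejected, and on completion the server leaves for a vacation. -/
def cbsCompletion (a : ℕ → ℝ) (h v : ℕ → ℕ → ℝ) : ℕ → ℝ
  | 0 => 0
  | l + 1 => resumeTime a (v l) (cbsCompletion a h v l) + h l 0

/-- Generation times of the informative packets in CBS: the buffer holds the freshest packet that
has arrived when the server resumes work. -/
def cbsGeneration (a : ℕ → ℝ) (h v : ℕ → ℕ → ℝ) : ℕ → ℝ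
  | 0 => 0
  | l + 1 => lastArrival a (resumeTime a (v l) (cbsCompletion a h v l))

/-- With preemption, the start of the `j`-th service in a busy period that begins at time `s`,
provided that all the services before it have been preempted: every arrival during a service
starts a new one at once. -/
def attemptStart (a : ℕ → ℝ) (s : ℝ) : ℕ → ℝ
  | 0 => s
  | j + 1 => nextArrival a (attemptStart a s j)

/-- The number of preempted services in a busy period that begins at time `s`, when the successive
packets put in service have service times `h 0, h 1, …`: the first service that no arrival
interrupts is completed. -/
def preemptions (a h : ℕ → ℝ) (s : ℝ) : ℕ :=
  sInf {j | ¬ ArrivalIn a (attemptStart a s j) (attemptStart a s j + h j)}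

/-- The start of the service that is completed, in a busy period that begins at time `s`. -/
def lastAttemptStart (a h : ℕ → ℝ) (s : ℝ) : ℝ :=
  attemptStart a s (preemptions a h s)

/-- Completion times of the informative packets in the Conventional Buffer System with Preemption
in Service (CBS-P). -/
def cbspCompletion (a : ℕ → ℝ) (h v : ℕ → ℕ → ℝ) : ℕ → ℝ
  | 0 => 0
  | l + 1 =>
    let s := resumeTime a (v l) (cbspCompletion a h v l)
    lastAttemptStart a (h l) s + h l (preemptions a (h l) s)

/-- Generation times of the informative packets in CBS-P: the packet in service is always the
freshest one, so the packet that is completed is the last one that has arrived when its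
service starts (at that very moment, if it has preempted another one). -/
def cbspGeneration (a : ℕ → ℝ) (h v : ℕ → ℕ → ℝ) : ℕ → ℝ
  | 0 => 0
  | l + 1 =>
    lastArrival a (lastAttemptStart a (h l) (resumeTime a (v l) (cbspCompletion a h v l)))

/-- The age at time `t`, if the `l`-th informative packet is generated at time `r l` and completed
at time `C l`: `Δ(t) = t - max {r l : C l ≤ t}`. -/
def age (C r : ℕ → ℝ) (t : ℝ) : ℝ :=
  t - sSup {x | ∃ l, x = r l ∧ C l ≤ t}

/-- The peaks of the age: the age just before the `(l+1)`-st completion, when the freshest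
completed packet is the `l`-th one. -/
def peakAge (C r : ℕ → ℝ) (l : ℕ) : ℝ :=
  C (l + 1) - r l

/-- The average over the time interval `(0, τ]` of a nonnegative function of time. -/
def timeAverage (f : ℝ → ℝ) (τ : ℝ) : ℝ≥0∞ :=
  (∫⁻ t in Set.Ioc 0 τ, ENNReal.ofReal (f t)) / ENNReal.ofReal τ

/-- The average of the first `k` terms of a nonnegative sequence. -/
def sequenceAverage (f : ℕ → ℝ) (k : ℕ) : ℝ≥0∞ :=
  (∑ l ∈ Finset.range k, ENNReal.ofReal (f l)) / k

/-! ### The stochastic model -/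

/-- The random data of the system: `T n` are the times between successive arrivals, `H (l, j)` the
service times and `V (l, j)` the vacation times. Arrivals are Poisson with rate `lam`, service
times are exponential with rate `mu`, vacation times are i.i.d. with law `ν`, and all these
variables are mutually independent. -/
structure IsModel {Ω : Type*} [MeasurableSpace Ω] (P : Measure Ω) (lam mu : ℝ) (ν : Measure ℝ)
    (T : ℕ → Ω → ℝ) (H V : ℕ × ℕ → Ω → ℝ) : Prop where
  measurable_T : ∀ n, Measurable (T n)
  measurable_H : ∀ p, Measurable (H p)
  measurable_V : ∀ p, Measurable (V p)
  law_T : ∀ n, P.map (T n) = expMeasure lam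
  law_H : ∀ p, P.map (H p) = expMeasure mu
  law_V : ∀ p, P.map (V p) = ν
  indep : iIndepFun (Sum.elim T (Sum.elim H V)) P

variable {Ω : Type*}

/-- The arrival times: partial sums of the interarrival times. -/
def arrivals (T : ℕ → Ω → ℝ) (ω : Ω) (n : ℕ) : ℝ :=
  ∑ i ∈ Finset.range (n + 1), T i ω

/-- The age process `Δ(t)` in CBS. -/
def cbsAge (T : ℕ → Ω → ℝ) (H V : ℕ × ℕ → Ω → ℝ) (t : ℝ) (ω : Ω) : ℝ :=
  age (cbsCompletion (arrivals T ω) (fun l j => H (l, j) ω) (fun l j => V (l, j) ω))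
    (cbsGeneration (arrivals T ω) (fun l j => H (l, j) ω) (fun l j => V (l, j) ω)) t

/-- The age peaks in CBS. -/
def cbsPeak (T : ℕ → Ω → ℝ) (H V : ℕ × ℕ → Ω → ℝ) (l : ℕ) (ω : Ω) : ℝ :=
  peakAge (cbsCompletion (arrivals T ω) (fun l j => H (l, j) ω) (fun l j => V (l, j) ω))
    (cbsGeneration (arrivals T ω) (fun l j => H (l, j) ω) (fun l j => V (l, j) ω)) l

/-- The age process `Δ(t)` in CBS-P. -/
def cbspAge (T : ℕ → Ω → ℝ) (H V : ℕ × ℕ → Ω → ℝ) (t : ℝ) (ω : Ω) : ℝ :=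
  age (cbspCompletion (arrivals T ω) (fun l j => H (l, j) ω) (fun l j => V (l, j) ω))
    (cbspGeneration (arrivals T ω) (fun l j => H (l, j) ω) (fun l j => V (l, j) ω)) t

/-- The age peaks in CBS-P. -/
def cbspPeak (T : ℕ → Ω → ℝ) (H V : ℕ × ℕ → Ω → ℝ) (l : ℕ) (ω : Ω) : ℝ :=
  peakAge (cbspCompletion (arrivals T ω) (fun l j => H (l, j) ω) (fun l j => V (l, j) ω))
    (cbspGeneration (arrivals T ω) (fun l j => H (l, j) ω) (fun l j => V (l, j) ω)) l

/-- `a` is the average age of information as a time average: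
`lim_{τ → ∞} (1/τ) ∫_0^τ Δ(t) dt = a` almost surely. -/
def IsTimeAverageAge [MeasurableSpace Ω] (P : Measure Ω) (D : ℝ → Ω → ℝ) (a : ℝ≥0∞) : Prop :=
  ∀ᵐ ω ∂P, Tendsto (timeAverage (fun t => D t ω)) atTop (𝓝 a)

/-- `d` is the average age of information as a limit of expectations:
`lim_{t → ∞} E[Δ(t)] = d`. -/
def IsLimitExpectedAge [MeasurableSpace Ω] (P : Measure Ω) (D : ℝ → Ω → ℝ) (d : ℝ≥0∞) : Prop :=
  Tendsto (fun t => ∫⁻ ω, ENNReal.ofReal (D t ω) ∂P) atTop (𝓝 d)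

/-- `p` is the average peak age of information: `lim_{k → ∞} (1/k) ∑_{l < k} A_l = p` almost
surely, and also `lim_{l → ∞} E[A_l] = p`. -/
def IsPeakAge [MeasurableSpace Ω] (P : Measure Ω) (A : ℕ → Ω → ℝ) (p : ℝ≥0∞) : Prop :=
  (∀ᵐ ω ∂P, Tendsto (sequenceAverage (fun l => A l ω)) atTop (𝓝 p)) ∧
    Tendsto (fun l => ∫⁻ ω, ENNReal.ofReal (A l ω) ∂P) atTop (𝓝 p)

end

end VacationQueue

/-! Cut time at the completions. A cycle is an idle phase (vacations until one ends with a packet in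
the buffer) followed by a service phase. Both phases end at stopping times of the arrival process,
so by `strongMarkov` the interarrival times seen afterwards are again i.i.d. exponential and
independent of the past. Hence one cycle reproduces the law of its input independently of its
outcome (`measurePreserving_cycle_nextInput`), and the outcomes of the successive cycles are i.i.d.
(`map_orbit_eq_iidLaw`).

The heart of the comparison is memorylessness: when an arrival replaces a running exponential
service by a fresh one, the law of the remaining time is unchanged. So the service phase of CBS-P is
exponential with parameter `mu` (`map_cappedDuration`), as in CBS, and it is independent of the idle
phase in both systems. The pair `boundPair`, which records the cycle length and the age at
completion that the first packet in service would have, therefore has one law for all disciplines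
(`map_boundPair`). In CBS it is the true pair `cyclePair`; in CBS-P the length is the true one,
while the completed packet is at least as fresh as the first one (`cyclePair_le_boundPair`).

With X the cycle length and Y the age of the packet at completion, renewal reward arguments give the
time average (E[Y] E[X] + E[X²/2]) / E[X], or infinity if E[X] is infinite
(`ae_tendsto_timeAverage`), and the peak average E[X] + E[Y] (`ae_tendsto_sequenceAverage`). The
product E[Y] E[X] appears because the age at the start of a cycle comes from the previous,
independent cycle. Both values increase with E[Y] when the law of X is fixed (`means_le`). For the
expected age at a fixed time the same replacement of pairs acts pathwise (`lintegral_cycleAge_le`).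
Finally `eq_epoch_stamp` identifies the recursively defined sample paths with these cycle sequences.
-/

namespace VacationQueue

noncomputable section

/-! ### Infinite products of probability measures -/

/-- The first `k` terms of `p`, followed by the sequence `q`. -/
def concat {X : Type*} (k : ℕ) (p q : ℕ → X) (i : ℕ) : X :=
  if i < k then p i else q (i - k)

/-- The law of a sequence of independent variables with law `m`. -/
abbrev iidLaw {X : Type*} [MeasurableSpace X] (m : Measure X) : Measure (ℕ → X) :=
  Measure.infinitePi fun _ => m

theorem map_sumElim_infinitePi {X ι κ : Type*} [MeasurableSpace X]
    (μ : ι → Measure X) (ν : κ → Measure X) [∀ i, IsProbabilityMeasure (μ i)]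
    [∀ i, IsProbabilityMeasure (ν i)] [∀ i, IsProbabilityMeasure (Sum.elim μ ν i)] :
    ((Measure.infinitePi μ).prod (Measure.infinitePi ν)).map (fun p => Sum.elim p.1 p.2) =
      Measure.infinitePi (Sum.elim μ ν) := by
  have hm : Measurable (fun p : (ι → X) × (κ → X) => (Sum.elim p.1 p.2 : ι ⊕ κ → X)) := by
    refine measurable_pi_iff.2 fun i => ?_
    cases i <;> simp only [Sum.elim_inl, Sum.elim_inr] <;> fun_prop
  apply Measure.eq_infinitePi
  intro s t ht
  rw [Measure.map_apply hm (.pi s.countable_toSet fun i _ => ht i)]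
  have : (fun p : (ι → X) × (κ → X) => (Sum.elim p.1 p.2 : ι ⊕ κ → X)) ⁻¹' (s : Set (ι ⊕ κ)).pi t =
      ((s.toLeft : Set ι).pi fun i => t (Sum.inl i)) ×ˢ
        ((s.toRight : Set κ).pi fun i => t (Sum.inr i)) := by
    ext p
    simp [Set.mem_pi, Sum.forall]
  rw [this, Measure.prod_prod, Measure.infinitePi_pi _ fun i _ => ht _,
    Measure.infinitePi_pi _ fun i _ => ht _]
  conv_rhs => rw [← Finset.toLeft_disjSum_toRight (u := s), Finset.prod_disjSum]
  simp

theorem measurable_concat {X : Type*} [MeasurableSpace X] (k : ℕ) :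
    Measurable (fun p : (ℕ → X) × (ℕ → X) => concat k p.1 p.2) := by
  refine measurable_pi_iff.2 fun i => ?_
  unfold concat
  split_ifs <;> fun_prop

/-- The concatenation reads each coordinate of the two sequences at most once, so it is a
restriction of an i.i.d. family along an injection. It serves to freeze the first `k` terms and
resample the others. -/
theorem measurePreserving_concat {X : Type*} [MeasurableSpace X] (m : Measure X)
    [IsProbabilityMeasure m] (k : ℕ) :
    MeasurePreserving (fun p : (ℕ → X) × (ℕ → X) => concat k p.1 p.2)
      ((iidLaw m).prod (iidLaw m)) (iidLaw m) := by
  refine ⟨measurable_concat k, ?_⟩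
  let j : ℕ → ℕ ⊕ ℕ := fun i => if i < k then Sum.inl i else Sum.inr (i - k)
  have hj : Function.Injective j := by
    intro a b hab
    simp only [j] at hab
    split_ifs at hab <;> simp at hab <;> omega
  have hcomp : (fun p : (ℕ → X) × (ℕ → X) => concat k p.1 p.2) =
      (fun (ω : ℕ ⊕ ℕ → X) i => ω (j i)) ∘ fun p => Sum.elim p.1 p.2 := by
    funext p i
    simp only [concat, j, Function.comp]
    split_ifs <;> simp
  have helim : (Sum.elim (fun _ : ℕ => m) (fun _ : ℕ => m)) = fun _ => m := by
    funext i; cases i <;> rfl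
  have : ∀ i, IsProbabilityMeasure (Sum.elim (fun _ : ℕ => m) (fun _ : ℕ => m) i) := by
    rw [helim]; infer_instance
  rw [hcomp, ← Measure.map_map (by fun_prop) ?_, map_sumElim_infinitePi]
  · simp_rw [helim]
    exact Measure.map_infinitePi_infinitePi_of_inj hj
  · refine measurable_pi_iff.2 fun i => ?_
    cases i <;> simp only [Sum.elim_inl, Sum.elim_inr] <;> fun_prop

theorem measurePreserving_head_tail {X : Type*} [MeasurableSpace X] (m : Measure X)
    [IsProbabilityMeasure m] :
    MeasurePreserving (fun f : ℕ → X => (f 0, fun n => f (n + 1)))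
      (iidLaw m) (m.prod (iidLaw m)) := by
  have h1 : MeasurePreserving (Prod.map (Function.eval 0) id)
      ((iidLaw m).prod (iidLaw m)) (m.prod (iidLaw m)) :=
    (measurePreserving_eval_infinitePi (fun _ : ℕ => m) 0).prod (MeasurePreserving.id _)
  refine ⟨by fun_prop, ?_⟩
  rw [← h1.map_eq]
  conv_lhs => rw [← (measurePreserving_concat m 1).map_eq]
  rw [Measure.map_map (by fun_prop) (measurable_concat 1)]
  rfl

/-- Second Borel–Cantelli lemma. All statements that times do not accumulate rest on it. -/
theorem ae_frequently_mem {X : Type*} [MeasurableSpace X] (m : Measure X)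
    [IsProbabilityMeasure m] {A : Set X} (hA : MeasurableSet A) (h : m A ≠ 0) :
    ∀ᵐ f ∂(iidLaw m), ∃ᶠ n in atTop, f n ∈ A := by
  have hev : ∀ n, MeasurableSet ((fun f : ℕ → X => f n) ⁻¹' A) := fun n =>
    measurable_pi_apply n hA
  have hind : iIndepFun (fun n (f : ℕ → X) => f n) (iidLaw m) :=
    iIndepFun_infinitePi (P := fun _ : ℕ => m) (X := fun _ => id) fun _ => measurable_id
  have hset : iIndepSet (fun n => (fun f : ℕ → X => f n) ⁻¹' A) (iidLaw m) := by
    rw [iIndepSet_iff_meas_biInter hev]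
    intro s
    exact hind.measure_inter_preimage_eq_mul s fun i _ => hA
  have hval : ∀ n, iidLaw m ((fun f : ℕ → X => f n) ⁻¹' A) = m A := fun n =>
    (measurePreserving_eval_infinitePi (fun _ : ℕ => m) n).measure_preimage hA.nullMeasurableSet
  have := measure_limsup_eq_one hev hset (by simp_rw [hval]; exact ENNReal.tsum_const_eq_top_of_ne_zero h)
  have hlim : MeasurableSet (limsup (fun n => (fun f : ℕ → X => f n) ⁻¹' A) atTop) :=
    MeasurableSet.measurableSet_limsup hev
  rw [← prob_compl_eq_zero_iff hlim] at this
  have h2 : ∀ᵐ f ∂(iidLaw m), f ∈ limsup (fun n => (fun f : ℕ → X => f n) ⁻¹' A) atTop := this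
  filter_upwards [h2] with f hf
  rwa [mem_limsup_iff_frequently_mem] at hf

/-- If one step of a system produces an output and a new state that are independent, and the new
state has the law of the old one, then the successive outputs are independent and identically
distributed. -/
theorem map_orbit_eq_iidLaw {E Z : Type*} [MeasurableSpace E] [MeasurableSpace Z]
    (Q : Measure E) [IsProbabilityMeasure Q] (ρ : Measure Z) [IsProbabilityMeasure ρ]
    (out : E → Z) (Φ : E → E) (hout : Measurable out) (hΦ : Measurable Φ)
    (h : Q.map (fun e => (out e, Φ e)) = ρ.prod Q) :
    Q.map (fun e n => out (Φ^[n] e)) = iidLaw ρ := by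
  have hm : Measurable (fun e n => out (Φ^[n] e)) :=
    measurable_pi_iff.2 fun n => hout.comp (hΦ.iterate n)
  -- Cylinder probabilities factor by peeling off the first output: the later outputs are those of
  -- the orbit of `Φ e`. The family `B` is quantified inside the induction because it is shifted.
  have key : ∀ (n : ℕ) (B : ℕ → Set Z), (∀ i, MeasurableSet (B i)) →
      Q {e | ∀ i < n, out (Φ^[i] e) ∈ B i} = ∏ i ∈ Finset.range n, ρ (B i) := by
    intro n
    induction n with
    | zero => intro B _; simp
    | succ n ih =>
      intro B hB
      have hD : MeasurableSet {e | ∀ i < n, out (Φ^[i] e) ∈ B (i + 1)} := by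
        simp only [Set.ofPred_forall]
        exact MeasurableSet.iInter fun i => MeasurableSet.iInter fun _ =>
          (hout.comp (hΦ.iterate i)) (hB (i + 1))
      have : {e | ∀ i < n + 1, out (Φ^[i] e) ∈ B i} =
          (fun e => (out e, Φ e)) ⁻¹' (B 0 ×ˢ {e | ∀ i < n, out (Φ^[i] e) ∈ B (i + 1)}) := by
        ext e
        simp only [Set.mem_ofPred_eq, Set.mem_preimage, Set.mem_prod]
        constructor
        · intro H
          exact ⟨H 0 (by omega), fun i hi => H (i + 1) (by omega)⟩
        · rintro ⟨H0, H⟩ i hi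
          cases i with
          | zero => exact H0
          | succ i => exact H i (by omega)
      rw [this, ← Measure.map_apply (by fun_prop) ((hB 0).prod hD), h, Measure.prod_prod,
        ih _ fun i => hB (i + 1), Finset.prod_range_succ', mul_comm]
  apply Measure.eq_infinitePi
  intro s t ht
  classical
  rw [Measure.map_apply hm (.pi s.countable_toSet fun i _ => ht i)]
  obtain ⟨n, hn⟩ : ∃ n, s ⊆ Finset.range n := Finset.exists_nat_subset_range s
  have := key n (fun i => if i ∈ s then t i else Set.univ) (by
    intro i; split_ifs; exacts [ht i, .univ])
  have hs : (fun e n => out (Φ^[n] e)) ⁻¹' (s : Set ℕ).pi t =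
      {e | ∀ i < n, out (Φ^[i] e) ∈ if i ∈ s then t i else Set.univ} := by
    ext e
    simp only [Set.mem_preimage, Set.mem_pi, Set.mem_ofPred_eq, Finset.mem_coe]
    constructor
    · intro H i _
      split_ifs with hi
      exacts [H i hi, trivial]
    · intro H i hi
      have := H i (Finset.mem_range.1 (hn hi))
      rwa [if_pos hi] at this
  rw [hs, this, ← Finset.prod_subset hn]
  · exact Finset.prod_congr rfl fun i hi => by rw [if_pos hi]
  · intro i _ hi
    rw [if_neg hi, measure_univ]

theorem ae_orbit {E : Type*} [MeasurableSpace E] {Q : Measure E} {Φ : E → E}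
    (hΦ : MeasurePreserving Φ Q Q) {p : E → Prop} (hp : ∀ᵐ e ∂Q, p e) :
    ∀ᵐ e ∂Q, ∀ n, p (Φ^[n] e) :=
  ae_all_iff.2 fun n => (hΦ.iterate n).quasiMeasurePreserving.ae hp

/-! ### Measurability -/

theorem measurable_sInf_nat {α : Type*} [MeasurableSpace α] {p : α → ℕ → Prop}
    (hp : ∀ n, MeasurableSet {x | p x n}) : Measurable (fun x => sInf {n | p x n}) := by
  refine measurable_to_countable' fun n => ?_
  -- The last set is the contribution of the convention `sInf ∅ = 0`.
  have h : (fun x => sInf {n | p x n}) ⁻¹' {n} =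
      ({x | p x n} ∩ ⋂ m, ⋂ (_ : m < n), {x | p x m}ᶜ) ∪ {x | n = 0 ∧ ∀ m, ¬ p x m} := by
    ext x
    simp only [Set.mem_preimage, Set.mem_singleton_iff, Set.mem_union, Set.mem_inter_iff,
      Set.mem_ofPred_eq, Set.mem_iInter, Set.mem_compl_iff]
    constructor
    · rintro rfl
      by_cases hne : {n | p x n}.Nonempty
      · exact Or.inl ⟨Nat.sInf_mem hne, fun m hm => Nat.notMem_of_lt_sInf hm⟩
      · rw [Set.not_nonempty_iff_eq_empty] at hne
        refine Or.inr ⟨by rw [hne, Nat.sInf_empty], fun m hm => ?_⟩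
        have : m ∈ {n | p x n} := hm
        rw [hne] at this
        exact this
    · rintro (⟨h1, h2⟩ | ⟨rfl, h2⟩)
      · refine le_antisymm (Nat.sInf_le h1) ?_
        by_contra hlt
        exact h2 _ (not_le.1 hlt) (Nat.sInf_mem (s := {n | p x n}) ⟨n, h1⟩)
      · have : {n | p x n} = ∅ := Set.eq_empty_of_forall_notMem h2
        rw [this, Nat.sInf_empty]
  rw [h]
  refine ((hp n).inter (MeasurableSet.iInter fun m => MeasurableSet.iInter fun _ =>
    (hp m).compl)).union ?_
  by_cases hn : n = 0
  · simp only [hn, true_and, Set.ofPred_forall]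
    exact MeasurableSet.iInter fun m => (hp m).compl
  · simp [hn]

theorem measurable_apply_nat {α β : Type*} [MeasurableSpace α] [MeasurableSpace β] {N : α → ℕ}
    (hN : Measurable N) {f : ℕ → α → β} (hf : ∀ n, Measurable (f n)) :
    Measurable (fun x => f (N x) x) := by
  have : Measurable (fun p : ℕ × α => f p.1 p.2) := measurable_from_prod_countable_right hf
  exact this.comp (hN.prodMk measurable_id)

/-! ### The exponential law -/

/-- Translating the exponential density by `c` multiplies it by the constant `exp (-(r * c))`. -/
theorem lintegral_expMeasure_memoryless {r : ℝ} (hr : 0 < r) {c : ℝ} (hc : 0 ≤ c) {f : ℝ → ℝ≥0∞}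
    (hf : Measurable f) :
    ∫⁻ x, (Set.Ioi c).indicator (fun x => f (x - c)) x ∂(expMeasure r) =
      expMeasure r (Set.Ioi c) * ∫⁻ x, f x ∂(expMeasure r) := by
  have hpdf : Measurable (exponentialPDF r) := by unfold exponentialPDF; fun_prop
  have general : ∀ g : ℝ → ℝ≥0∞, Measurable g →
      ∫⁻ x, (Set.Ioi c).indicator (fun x => g (x - c)) x ∂(expMeasure r) =
      ENNReal.ofReal (Real.exp (-(r * c))) * ∫⁻ x, g x ∂(expMeasure r) := by
    intro g hg
    have he : expMeasure r = volume.withDensity (exponentialPDF r) := rfl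
    rw [he, lintegral_withDensity_eq_lintegral_mul _ hpdf
      ((show Measurable (fun x => g (x - c)) by fun_prop).indicator measurableSet_Ioi),
      lintegral_withDensity_eq_lintegral_mul _ hpdf hg,
      ← lintegral_const_mul _ (hpdf.mul hg),
      ← lintegral_sub_right_eq_self
        (fun x => ENNReal.ofReal (Real.exp (-(r * c))) * (exponentialPDF r * g) x) c]
    -- At `x = c` the open ray and the density at `0` disagree, so this point is discarded.
    have hne : ∀ᵐ x : ℝ, x ≠ c := by
      simp [ae_iff]
    refine lintegral_congr_ae (hne.mono fun x hx => ?_)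
    simp only [Pi.mul_apply]
    by_cases hxc : c < x
    · rw [Set.indicator_of_mem (Set.mem_Ioi.2 hxc), exponentialPDF_of_nonneg (by linarith),
        exponentialPDF_of_nonneg (by linarith), ← mul_assoc,
        ← ENNReal.ofReal_mul (Real.exp_pos _).le]
      congr 2
      rw [mul_left_comm, ← Real.exp_add]
      congr 2
      ring
    · have : x < c := lt_of_le_of_ne (not_lt.1 hxc) hx
      rw [Set.indicator_of_notMem (by simpa using hxc), exponentialPDF_of_neg (x := x - c) (by linarith)]
      simp
  have := isProbabilityMeasure_expMeasure hr
  -- The constant function identifies the factor with the mass of the ray.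
  have h1 := general (fun _ => 1) measurable_const
  rw [lintegral_indicator measurableSet_Ioi] at h1
  simp only [lintegral_const, Measure.restrict_apply_univ, one_mul, measure_univ, mul_one] at h1
  rw [general f hf, h1]

theorem ae_expMeasure_pos {r : ℝ} : ∀ᵐ x ∂(expMeasure r), 0 < x := by
  have he : expMeasure r = volume.withDensity (exponentialPDF r) := rfl
  have hpdf : Measurable (exponentialPDF r) := by unfold exponentialPDF; fun_prop
  rw [he, ae_withDensity_iff hpdf]
  have hne : ∀ᵐ x : ℝ, x ≠ 0 := by simp [ae_iff]
  filter_upwards [hne] with x hx h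
  by_contra hlt
  exact h (exponentialPDF_of_neg (lt_of_le_of_ne (not_lt.1 hlt) hx))

theorem expMeasure_Ioi_ne_zero {r : ℝ} (hr : 0 < r) (c : ℝ) : expMeasure r (Set.Ioi c) ≠ 0 := by
  have := isProbabilityMeasure_expMeasure hr
  rw [← Set.compl_Iic, Ne, prob_compl_eq_zero_iff measurableSet_Iic, ← ofReal_cdf,
    cdf_expMeasure_eq hr]
  have := Real.exp_pos (-(r * c))
  split_ifs <;> simp

theorem expMeasure_Iio_ne_zero {r : ℝ} (hr : 0 < r) {c : ℝ} (hc : 0 < c) :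
    expMeasure r (Set.Iio c) ≠ 0 := by
  have := isProbabilityMeasure_expMeasure hr
  refine fun h => (?_ : expMeasure r (Set.Iic (c / 2)) ≠ 0)
    (measure_mono_null (fun x hx => ?_) h)
  · rw [← ofReal_cdf, cdf_expMeasure_eq hr, if_pos (by positivity)]
    simp
    positivity
  · simp only [Set.mem_Iic, Set.mem_Iio] at *
    linarith

/-! ### The strong Markov property of the arrival process -/

/-- The arrival times with interarrival times `t`. -/
def arr (t : ℕ → ℝ) (n : ℕ) : ℝ := ∑ i ∈ Finset.range (n + 1), t i

/-- The number of arrivals up to and including time `u`. -/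
def count (t : ℕ → ℝ) (u : ℝ) : ℕ := sInf {n | u < arr t n}

/-- The interarrival times of the arrival process that starts afresh at time `u`. -/
def residual (t : ℕ → ℝ) (u : ℝ) (k : ℕ) : ℝ :=
  if k = 0 then arr t (count t u) - u else t (count t u + k)

/-- The arrivals are simple and do not accumulate. -/
def Good (t : ℕ → ℝ) : Prop := (∀ i, 0 < t i) ∧ ∀ u, ∃ n, u < arr t n

theorem arr_succ (t : ℕ → ℝ) (n : ℕ) : arr t (n + 1) = arr t n + t (n + 1) :=
  Finset.sum_range_succ t (n + 1)

theorem arr_zero (t : ℕ → ℝ) : arr t 0 = t 0 := by simp [arr]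

theorem Good.strictMono {t : ℕ → ℝ} (ht : Good t) : StrictMono (arr t) :=
  strictMono_nat_of_lt_succ fun n => by rw [arr_succ]; linarith [ht.1 (n + 1)]

theorem Good.arr_pos {t : ℕ → ℝ} (ht : Good t) (n : ℕ) : 0 < arr t n :=
  Finset.sum_pos (fun i _ => ht.1 i) (by simp)

theorem Good.lt_arr_count {t : ℕ → ℝ} (ht : Good t) (u : ℝ) : u < arr t (count t u) :=
  Nat.sInf_mem (ht.2 u)

theorem arr_le_of_lt_count {t : ℕ → ℝ} {u : ℝ} {n : ℕ} (h : n < count t u) : arr t n ≤ u :=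
  not_lt.1 (Nat.notMem_of_lt_sInf h)

theorem Good.lt_count_iff {t : ℕ → ℝ} (ht : Good t) {u : ℝ} {n : ℕ} :
    n < count t u ↔ arr t n ≤ u := by
  refine ⟨arr_le_of_lt_count, fun h => ?_⟩
  by_contra hn
  exact absurd (ht.lt_arr_count u) (not_lt.2 ((ht.strictMono.monotone (not_lt.1 hn)).trans h))

theorem count_eq_of {t : ℕ → ℝ} {u : ℝ} {k : ℕ} (h1 : u < arr t k)
    (h2 : ∀ n < k, arr t n ≤ u) : count t u = k := by
  refine le_antisymm (Nat.sInf_le h1) (not_lt.1 fun hlt => ?_)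
  exact absurd (Nat.sInf_mem (s := {n | u < arr t n}) ⟨k, h1⟩) (not_lt.2 (h2 _ hlt))

theorem measurable_arr (n : ℕ) : Measurable (fun t : ℕ → ℝ => arr t n) := by
  unfold arr; fun_prop

theorem measurable_count {α : Type*} [MeasurableSpace α] {t : α → ℕ → ℝ} {u : α → ℝ}
    (ht : Measurable t) (hu : Measurable u) : Measurable (fun x => count (t x) (u x)) :=
  measurable_sInf_nat fun n => measurableSet_lt hu ((measurable_arr n).comp ht)

theorem measurable_residual {α : Type*} [MeasurableSpace α] {t : α → ℕ → ℝ} {u : α → ℝ}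
    (ht : Measurable t) (hu : Measurable u) : Measurable (fun x => residual (t x) (u x)) := by
  refine measurable_pi_iff.2 fun k => ?_
  unfold residual
  split_ifs
  · exact (measurable_apply_nat (measurable_count ht hu)
      (fun n => (measurable_arr n).comp ht)).sub hu
  · exact measurable_apply_nat (f := fun n x => t x (n + k)) (measurable_count ht hu)
      fun n => (measurable_pi_apply (n + k)).comp ht

theorem arr_concat_lt (k : ℕ) (p q : ℕ → ℝ) {n : ℕ} (h : n < k) : arr (concat k p q) n = arr p n :=
  Finset.sum_congr rfl fun i hi => by
    have := Finset.mem_range.1 hi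
    simp [concat, show i < k by omega]

theorem arr_concat_self (k : ℕ) (p q : ℕ → ℝ) :
    arr (concat k p q) k = (∑ i ∈ Finset.range k, p i) + q 0 := by
  unfold arr
  rw [Finset.sum_range_succ]
  congr 1
  · exact Finset.sum_congr rfl fun i hi => by simp [concat, Finset.mem_range.1 hi]
  · simp [concat]

theorem measure_eq_tsum_inter {α : Type*} [MeasurableSpace α] (Q : Measure α) {N : α → ℕ}
    (hN : Measurable N) {S : Set α} (hS : MeasurableSet S) :
    Q S = ∑' k, Q (S ∩ N ⁻¹' {k}) := by
  rw [← measure_iUnion]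
  · rw [← Set.inter_iUnion, ← Set.preimage_iUnion, Set.iUnion_of_singleton, Set.preimage_univ,
      Set.inter_univ]
  · intro i j hij
    refine Set.disjoint_left.2 ?_
    rintro x ⟨-, h1⟩ ⟨-, h2⟩
    exact hij (h1.symm.trans h2)
  · exact fun k => hS.inter (hN (measurableSet_singleton k))

/-- Fix all coordinates but the first and apply memorylessness to that one. In use, coordinate `0`
is the interarrival time that straddles the stopping time. -/
theorem iidLaw_expMeasure_memoryless {r : ℝ} (hr : 0 < r) {c : ℝ} (hc : 0 ≤ c)
    {G : Set (ℕ → ℝ)} (hG : MeasurableSet G) :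
    iidLaw (expMeasure r) {q | c < q 0 ∧ Function.update q 0 (q 0 - c) ∈ G} =
      iidLaw (expMeasure r) {q | c < q 0} * iidLaw (expMeasure r) G := by
  have := isProbabilityMeasure_expMeasure hr
  let cons : ℝ × (ℕ → ℝ) → ℕ → ℝ := fun p n => if n = 0 then p.1 else p.2 (n - 1)
  have hcons : Measurable cons := by
    refine measurable_pi_iff.2 fun n => ?_
    simp only [cons]
    split_ifs <;> fun_prop
  have hht := measurePreserving_head_tail (expMeasure r)
  have hS : MeasurableSet {p : ℝ × (ℕ → ℝ) | c < p.1 ∧ cons (p.1 - c, p.2) ∈ G} :=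
    (measurableSet_lt measurable_const measurable_fst).inter
      ((hcons.comp (by fun_prop : Measurable fun p : ℝ × (ℕ → ℝ) => (p.1 - c, p.2))) hG)
  have h1 : {q : ℕ → ℝ | c < q 0 ∧ Function.update q 0 (q 0 - c) ∈ G} =
      (fun f : ℕ → ℝ => (f 0, fun n => f (n + 1))) ⁻¹'
        {p : ℝ × (ℕ → ℝ) | c < p.1 ∧ cons (p.1 - c, p.2) ∈ G} := by
    ext q
    have : Function.update q 0 (q 0 - c) = cons (q 0 - c, fun n => q (n + 1)) := by
      funext n
      cases n <;> simp [cons]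
    simp [this]
  have h2 : iidLaw (expMeasure r) {q : ℕ → ℝ | c < q 0} = expMeasure r (Set.Ioi c) :=
    (measurePreserving_eval_infinitePi (fun _ : ℕ => expMeasure r) 0).measure_preimage
      (measurableSet_Ioi (a := c)).nullMeasurableSet
  have h3 : G = (fun f : ℕ → ℝ => (f 0, fun n => f (n + 1))) ⁻¹' (cons ⁻¹' G) := by
    ext q
    have : cons (q 0, fun n => q (n + 1)) = q := by
      funext n
      cases n <;> simp [cons]
    simp [this]
  rw [h1, h2, hht.measure_preimage hS.nullMeasurableSet]
  conv_rhs => rw [h3, hht.measure_preimage (hcons hG).nullMeasurableSet]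
  rw [Measure.prod_apply_symm hS, Measure.prod_apply_symm (hcons hG),
    ← lintegral_const_mul _ (measurable_measure_prodMk_right (hcons hG))]
  refine lintegral_congr fun q => ?_
  have hsec : MeasurableSet ((fun x => (x, q)) ⁻¹' (cons ⁻¹' G)) := measurable_prodMk_right (hcons hG)
  have := lintegral_expMeasure_memoryless hr hc
    (f := ((fun x => (x, q)) ⁻¹' (cons ⁻¹' G)).indicator 1) (measurable_one.indicator hsec)
  rw [lintegral_indicator_one hsec] at this
  rw [← this, ← lintegral_indicator_one (measurable_prodMk_right hS)]
  refine lintegral_congr fun x => ?_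
  by_cases h1 : c < x <;> by_cases h2 : cons (x - c, q) ∈ G <;>
    simp [Set.indicator, h1, h2]

/-- `Ξ` carries independent randomness, and `hadapted` expresses that `τ` and `O` depend on the
arrivals up to time `τ` only: later interarrival times may be changed as long as the next arrival
stays after `τ`. The proof splits according to the number `k` of arrivals up to `τ`. Given `ξ` and
the first `k` interarrival times, `τ` and `O` are constant on the event that this number is `k`, the
event only says that the next interarrival time exceeds a constant `c`, and the residual process
subtracts `c` from it, so memorylessness applies. -/
theorem strongMarkov {r : ℝ} (hr : 0 < r) {Ξ β : Type*} [MeasurableSpace Ξ] [MeasurableSpace β]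
    (κ : Measure Ξ) [IsProbabilityMeasure κ] (τ : (ℕ → ℝ) × Ξ → ℝ) (O : (ℕ → ℝ) × Ξ → β)
    (hτ : Measurable τ) (hO : Measurable O) (A : Set ((ℕ → ℝ) × Ξ))
    (hA : ∀ᵐ p ∂((iidLaw (expMeasure r)).prod κ), p ∈ A)
    (hgood : ∀ p ∈ A, Good p.1 ∧ 0 ≤ τ p)
    (hadapted : ∀ t ξ t', (t, ξ) ∈ A → Good t' → (∀ i < count t (τ (t, ξ)), t' i = t i) →
      τ (t, ξ) < arr t' (count t (τ (t, ξ))) →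
      (t', ξ) ∈ A ∧ τ (t', ξ) = τ (t, ξ) ∧ O (t', ξ) = O (t, ξ)) :
    MeasurePreserving (fun p => (O p, residual p.1 (τ p))) ((iidLaw (expMeasure r)).prod κ)
      ((((iidLaw (expMeasure r)).prod κ).map O).prod (iidLaw (expMeasure r))) := by
  have := isProbabilityMeasure_expMeasure hr
  set π := iidLaw (expMeasure r) with hπ
  have hres : Measurable (fun p : (ℕ → ℝ) × Ξ => residual p.1 (τ p)) :=
    measurable_residual measurable_fst hτ
  have hcount : Measurable (fun p : (ℕ → ℝ) × Ξ => count p.1 (τ p)) :=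
    measurable_count measurable_fst hτ
  have := Measure.isProbabilityMeasure_map (μ := π.prod κ) hO.aemeasurable
  refine ⟨hO.prodMk hres, (Measure.prod_eq fun B G hB hG => ?_).symm⟩
  rw [Measure.map_apply (hO.prodMk hres) (hB.prod hG), Measure.map_apply hO hB]
  have hpre : (fun p => (O p, residual p.1 (τ p))) ⁻¹' B ×ˢ G =
    O ⁻¹' B ∩ (fun p : (ℕ → ℝ) × Ξ => residual p.1 (τ p)) ⁻¹' G := rfl
  rw [hpre, measure_eq_tsum_inter _ hcount ((hO hB).inter (hres hG)),
    measure_eq_tsum_inter _ hcount (hO hB), ← ENNReal.tsum_mul_right]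
  refine tsum_congr fun k => ?_
  -- Write the interarrival times as a frozen prefix of length `k` and an independent continuation;
  -- below, the continuation is integrated first.
  let c3 : (Ξ × (ℕ → ℝ)) × (ℕ → ℝ) → (ℕ → ℝ) × Ξ := fun x => (concat k x.1.2 x.2, x.1.1)
  have hc3 : MeasurePreserving c3 ((κ.prod π).prod π) (π.prod κ) := by
    have h1 := measurePreserving_prodAssoc κ π π
    have h2 := (MeasurePreserving.id κ).prod (measurePreserving_concat (expMeasure r) k)
    exact (Measure.measurePreserving_swap.comp h2).comp h1
  have hN : MeasurableSet ((fun p : (ℕ → ℝ) × Ξ => count p.1 (τ p)) ⁻¹' {k}) :=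
    hcount (measurableSet_singleton k)
  have hS1 := (((hO hB).inter (hres hG)).inter hN)
  have hS2 := (hO hB).inter hN
  rw [← hc3.measure_preimage hS1.nullMeasurableSet, ← hc3.measure_preimage hS2.nullMeasurableSet,
    Measure.prod_apply (hc3.measurable hS1), Measure.prod_apply (hc3.measurable hS2),
    ← lintegral_mul_const _ (measurable_measure_prodMk_left (hc3.measurable hS2))]
  refine lintegral_congr_ae ?_
  filter_upwards [Measure.ae_ae_of_ae_prod (hc3.quasiMeasurePreserving.ae hA)] with x hx
  obtain ⟨ξ, p⟩ := x
  simp only [c3] at hx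
  have hcnt : ∀ q, τ (concat k p q, ξ) < (∑ i ∈ Finset.range k, p i) + q 0 →
      (∀ n < k, arr p n ≤ τ (concat k p q, ξ)) → count (concat k p q) (τ (concat k p q, ξ)) = k := by
    intro q h1 h2
    refine count_eq_of (by rwa [arr_concat_self]) fun n hn => ?_
    rw [arr_concat_lt k p q hn]
    exact h2 n hn
  -- A single continuation `q₀` that realizes `k` arrivals fixes the constants for this fibre;
  -- without one, both sides vanish.
  by_cases hex : ∃ q, (concat k p q, ξ) ∈ A ∧ count (concat k p q) (τ (concat k p q, ξ)) = k
  · obtain ⟨q₀, hq₀A, hq₀⟩ := hex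
    set σ := τ (concat k p q₀, ξ) with hσ
    set c := σ - ∑ i ∈ Finset.range k, p i with hc_def
    have hlow : ∀ n < k, arr p n ≤ σ := fun n hn => by
      rw [← arr_concat_lt k p q₀ hn]
      exact arr_le_of_lt_count (by rw [hq₀]; exact hn)
    have hc : 0 ≤ c := by
      rw [hc_def, sub_nonneg]
      rcases k with _ | k
      · simpa using (hgood _ hq₀A).2
      · exact hlow k (Nat.lt_succ_self k)
    have hagree : ∀ q q' : ℕ → ℝ, ∀ i < k, concat k p q i = concat k p q' i := by
      intro q q' i hi
      simp [concat, hi]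
    have hfwd : ∀ q, (concat k p q, ξ) ∈ A → c < q 0 →
        τ (concat k p q, ξ) = σ ∧ O (concat k p q, ξ) = O (concat k p q₀, ξ) ∧
        count (concat k p q) (τ (concat k p q, ξ)) = k := by
      intro q hqA hq
      have hlt : σ < (∑ i ∈ Finset.range k, p i) + q 0 := by linarith
      obtain ⟨-, h1, h2⟩ := hadapted _ _ (concat k p q) hq₀A (hgood _ hqA).1
        (by rw [hq₀]; exact hagree _ _) (by rw [hq₀, arr_concat_self]; exact hlt)
      refine ⟨h1, h2, hcnt q ?_ ?_⟩ <;> rw [h1]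
      exacts [hlt, hlow]
    have hbwd : ∀ q, (concat k p q, ξ) ∈ A →
        count (concat k p q) (τ (concat k p q, ξ)) = k → c < q 0 := by
      intro q hqA hq
      have hltq := (hgood _ hqA).1.lt_arr_count (τ (concat k p q, ξ))
      have hlt₀ := (hgood _ hq₀A).1.lt_arr_count σ
      simp only at hltq hlt₀
      rw [hq, arr_concat_self] at hltq
      rw [hq₀] at hlt₀
      -- If `q` stops no later than `q₀`, its stopping time also precedes the next arrival of `q₀`,
      -- and adaptedness used from `q` to `q₀` makes the two times equal. Otherwise `σ` lies before
      -- the next arrival of `q` directly.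
      rcases le_total (τ (concat k p q, ξ)) σ with hle | hle
      · obtain ⟨-, h1, -⟩ := hadapted _ _ (concat k p q₀) hqA (hgood _ hq₀A).1
          (by rw [hq]; exact hagree _ _) (by rw [hq]; exact hle.trans_lt hlt₀)
        rw [← hσ] at h1
        linarith
      · linarith
    have hresid : ∀ q, τ (concat k p q, ξ) = σ →
        count (concat k p q) (τ (concat k p q, ξ)) = k →
        residual (concat k p q) (τ (concat k p q, ξ)) = Function.update q 0 (q 0 - c) := by
      intro q h1 h2
      funext j
      rw [residual, h2]
      rcases j with _ | j
      · rw [if_pos rfl, h1, arr_concat_self, Function.update_self]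
        ring
      · rw [if_neg (by omega), Function.update_of_ne (by omega)]
        simp [concat]
    by_cases hB₀ : O (concat k p q₀, ξ) ∈ B
    · have e1 : Prod.mk (ξ, p) ⁻¹' (c3 ⁻¹' (O ⁻¹' B ∩
          (fun p : (ℕ → ℝ) × Ξ => residual p.1 (τ p)) ⁻¹' G ∩
            (fun p : (ℕ → ℝ) × Ξ => count p.1 (τ p)) ⁻¹' {k})) =ᵐ[π]
          {q | c < q 0 ∧ Function.update q 0 (q 0 - c) ∈ G} := by
        filter_upwards [hx] with q hq
        refine propext ⟨?_, ?_⟩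
        · rintro ⟨⟨-, h2⟩, h3⟩
          have h3' : count (concat k p q) (τ (concat k p q, ξ)) = k := h3
          have h4 := hbwd q hq h3'
          refine ⟨h4, ?_⟩
          rw [← hresid q (hfwd q hq h4).1 h3']
          exact h2
        · rintro ⟨h1, h2⟩
          obtain ⟨h3, h4, h5⟩ := hfwd q hq h1
          refine ⟨⟨?_, ?_⟩, h5⟩
          · change O (concat k p q, ξ) ∈ B
            rwa [h4]
          · change residual (concat k p q) (τ (concat k p q, ξ)) ∈ G
            rwa [hresid q h3 h5]
      have e2 : Prod.mk (ξ, p) ⁻¹' (c3 ⁻¹' (O ⁻¹' B ∩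
            (fun p : (ℕ → ℝ) × Ξ => count p.1 (τ p)) ⁻¹' {k})) =ᵐ[π] {q | c < q 0} := by
        filter_upwards [hx] with q hq
        refine propext ⟨fun h => hbwd q hq h.2, fun h => ?_⟩
        obtain ⟨h3, h4, h5⟩ := hfwd q hq h
        refine ⟨?_, h5⟩
        change O (concat k p q, ξ) ∈ B
        rwa [h4]
      rw [measure_congr e1, measure_congr e2, iidLaw_expMeasure_memoryless hr hc hG]
    · have z : ∀ᵐ q ∂π, ¬ (O (concat k p q, ξ) ∈ B ∧
          count (concat k p q) (τ (concat k p q, ξ)) = k) := by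
        filter_upwards [hx] with q hq
        rintro ⟨h1, h2⟩
        rw [(hfwd q hq (hbwd q hq h2)).2.1] at h1
        exact hB₀ h1
      rw [measure_mono_null (fun q hq => not_not.2 ⟨hq.1.1, hq.2⟩) z,
        measure_mono_null (fun q hq => not_not.2 ⟨hq.1, hq.2⟩) z, zero_mul]
  · have z : ∀ᵐ q ∂π, ¬ (count (concat k p q) (τ (concat k p q, ξ)) = k) := by
      filter_upwards [hx] with q hq h
      exact hex ⟨q, hq, h⟩
    rw [measure_mono_null (fun q hq => not_not.2 hq.2) z,
      measure_mono_null (fun q hq => not_not.2 hq.2) z, zero_mul]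

theorem exists_lt_sum_of_frequently {t : ℕ → ℝ} (ht : ∀ i, 0 ≤ t i) {δ : ℝ} (hδ : 0 < δ)
    (h : ∃ᶠ n in atTop, δ ≤ t n) (u : ℝ) : ∃ n, u < ∑ i ∈ Finset.range (n + 1), t i := by
  have hN : ∀ N : ℕ, ∃ n, N * δ ≤ ∑ i ∈ Finset.range n, t i := by
    intro N
    induction N with
    | zero => exact ⟨0, by simp⟩
    | succ N ih =>
      obtain ⟨n, hn⟩ := ih
      obtain ⟨m, hm, hδm⟩ := (frequently_atTop.1 h) n
      refine ⟨m + 1, ?_⟩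
      rw [Finset.sum_range_succ]
      have := Finset.sum_le_sum_of_subset_of_nonneg (Finset.range_mono hm) fun i _ _ => ht i
      push_cast
      linarith
  obtain ⟨N, hNu⟩ := exists_nat_gt (u / δ)
  obtain ⟨n, hn⟩ := hN N
  refine ⟨n, ?_⟩
  rw [Finset.sum_range_succ]
  rw [div_lt_iff₀ hδ] at hNu
  linarith [ht n]

theorem ae_good {r : ℝ} (hr : 0 < r) : ∀ᵐ t ∂(iidLaw (expMeasure r)), Good t := by
  have := isProbabilityMeasure_expMeasure hr
  have hpos : ∀ᵐ t ∂(iidLaw (expMeasure r)), ∀ i, 0 < t i := ae_all_iff.2 fun i =>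
    (measurePreserving_eval_infinitePi (fun _ : ℕ => expMeasure r) i).quasiMeasurePreserving.ae
      ae_expMeasure_pos
  filter_upwards [hpos, ae_frequently_mem (expMeasure r) (measurableSet_Ioi (a := 1))
    (expMeasure_Ioi_ne_zero hr 1)] with t ht hfr
  exact ⟨ht, fun u => (exists_lt_sum_of_frequently (fun i => (ht i).le) one_pos
    (hfr.mono fun n hn => le_of_lt hn) u)⟩

/-! ### The idle phase of a cycle -/

/-- The time of the last arrival up to time `u`, in terms of the number of arrivals. -/
def lastArr (t : ℕ → ℝ) (u : ℝ) : ℝ := if count t u = 0 then 0 else arr t (count t u - 1)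

/-- The vacation lengths are nonnegative and have an infinite sum. -/
def GoodVacations (v : ℕ → ℝ) : Prop :=
  (∀ i, 0 ≤ v i) ∧ ∀ u, ∃ n, u < ∑ i ∈ Finset.range (n + 1), v i

/-- The time at which the server resumes work, if it leaves at time `0`. -/
def resume (p : (ℕ → ℝ) × (ℕ → ℝ)) : ℝ := resumeTime (arr p.1) p.2 0

theorem Good.arrivalIn_zero_iff {t : ℕ → ℝ} (ht : Good t) {e : ℝ} :
    ArrivalIn (arr t) 0 e ↔ t 0 ≤ e := by
  constructor
  · rintro ⟨n, -, hn⟩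
    rw [← arr_zero t]
    exact (ht.strictMono.monotone (Nat.zero_le n)).trans hn
  · intro h
    exact ⟨0, ht.arr_pos 0, by rwa [arr_zero]⟩

theorem Good.resume_eq {t : ℕ → ℝ} (ht : Good t) (v : ℕ → ℝ) :
    resume (t, v) = vacationEnd v 0 (sInf {j | t 0 ≤ vacationEnd v 0 j}) := by
  simp only [resume, resumeTime, ht.arrivalIn_zero_iff]

theorem Good.le_resume {t v : ℕ → ℝ} (ht : Good t) (hv : GoodVacations v) :
    t 0 ≤ resume (t, v) := by
  rw [ht.resume_eq]
  refine Nat.sInf_mem (s := {j | t 0 ≤ vacationEnd v 0 j}) ?_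
  obtain ⟨n, hn⟩ := hv.2 (t 0)
  exact ⟨n, by simpa [vacationEnd] using hn.le⟩

theorem Good.count_pos {t : ℕ → ℝ} (ht : Good t) {u : ℝ} (h : t 0 ≤ u) : 0 < count t u :=
  ht.lt_count_iff.2 (by rwa [arr_zero])

theorem arr_congr {t t' : ℕ → ℝ} {k n : ℕ} (h : ∀ i < k, t' i = t i) (hn : n < k) :
    arr t' n = arr t n :=
  Finset.sum_congr rfl fun i hi => h i (by have := Finset.mem_range.1 hi; omega)

theorem Good.lastArr_mem {t : ℕ → ℝ} (ht : Good t) {u : ℝ} (h : t 0 ≤ u) :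
    0 < lastArr t u ∧ lastArr t u ≤ u := by
  have hc := ht.count_pos h
  rw [lastArr, if_neg hc.ne']
  exact ⟨ht.arr_pos _, arr_le_of_lt_count (by omega)⟩

theorem measurable_resume : Measurable resume := by
  unfold resume resumeTime
  refine measurable_apply_nat (f := fun j (p : (ℕ → ℝ) × (ℕ → ℝ)) => vacationEnd p.2 0 j)
    (measurable_sInf_nat fun j => ?_) fun j => ?_
  · simp only [ArrivalIn, Set.ofPred_exists]
    refine MeasurableSet.iUnion fun n => ?_
    exact (measurableSet_lt measurable_const ((measurable_arr n).comp measurable_fst)).inter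
      (measurableSet_le ((measurable_arr n).comp measurable_fst) (by unfold vacationEnd; fun_prop))
  · unfold vacationEnd; fun_prop

theorem measurable_lastArr {α : Type*} [MeasurableSpace α] {t : α → ℕ → ℝ} {u : α → ℝ}
    (ht : Measurable t) (hu : Measurable u) : Measurable (fun x => lastArr (t x) (u x)) := by
  unfold lastArr
  refine measurable_apply_nat (f := fun n x => if n = 0 then (0 : ℝ) else arr (t x) (n - 1))
    (measurable_count ht hu) fun n => ?_
  split_ifs
  · exact measurable_const
  · exact (measurable_arr _).comp ht

/-- The resume time together with the generation time of the packet in the buffer then. -/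
def idlePhase (p : (ℕ → ℝ) × (ℕ → ℝ)) : ℝ × ℝ := (resume p, lastArr p.1 (resume p))

theorem measurable_idlePhase : Measurable idlePhase :=
  measurable_resume.prodMk (measurable_lastArr measurable_fst measurable_resume)

theorem ae_goodVacations (ν : Measure ℝ) [IsProbabilityMeasure ν] (hν : ν (Set.Iio 0) = 0)
    (hν0 : ν (Set.Ioi 0) ≠ 0) : ∀ᵐ v ∂(iidLaw ν), GoodVacations v := by
  have hnn : ∀ᵐ x ∂ν, 0 ≤ x := by
    rw [ae_iff]
    simpa [Set.Iio] using hν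
  have hall : ∀ᵐ v ∂(iidLaw ν), ∀ i, 0 ≤ v i := ae_all_iff.2 fun i =>
    (measurePreserving_eval_infinitePi (fun _ : ℕ => ν) i).quasiMeasurePreserving.ae hnn
  -- A law with mass on the positive axis charges lengths above some positive threshold, and
  -- infinitely many vacations exceed it.
  obtain ⟨n, hn⟩ : ∃ n : ℕ, ν (Set.Ici ((1 : ℝ) / (n + 1))) ≠ 0 := by
    by_contra! h
    refine hν0 (measure_mono_null (fun x hx => ?_) (measure_iUnion_null h))
    obtain ⟨n, hn⟩ := exists_nat_one_div_lt (Set.mem_Ioi.1 hx)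
    exact Set.mem_iUnion.2 ⟨n, hn.le⟩
  filter_upwards [hall, ae_frequently_mem ν measurableSet_Ici hn] with v hv hfr
  exact ⟨hv, exists_lt_sum_of_frequently hv (by positivity) hfr⟩

/-- The resume time depends on the vacations and the first arrival only, and that arrival has
happened by then; the buffered packet is determined by the arrivals up to that time. So the strong
Markov property applies. -/
theorem measurePreserving_idlePhase {r : ℝ} (hr : 0 < r) (ν : Measure ℝ) [IsProbabilityMeasure ν]
    (hν : ν (Set.Iio 0) = 0) (hν0 : ν (Set.Ioi 0) ≠ 0) :
    MeasurePreserving (fun p => (idlePhase p, residual p.1 (resume p)))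
      ((iidLaw (expMeasure r)).prod (iidLaw ν))
      ((((iidLaw (expMeasure r)).prod (iidLaw ν)).map idlePhase).prod (iidLaw (expMeasure r))) := by
  have := isProbabilityMeasure_expMeasure hr
  refine strongMarkov hr (iidLaw ν) resume idlePhase measurable_resume measurable_idlePhase
    {p | Good p.1 ∧ GoodVacations p.2} ?_ ?_ ?_
  · exact (Measure.quasiMeasurePreserving_fst.ae (ae_good hr)).and
      (Measure.quasiMeasurePreserving_snd.ae (ae_goodVacations ν hν hν0))
  · rintro ⟨t, v⟩ ⟨ht, hv⟩
    exact ⟨ht, (ht.1 0).le.trans (ht.le_resume hv)⟩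
  · rintro t v t' ⟨ht, hv⟩ ht' hag hlt
    have hc := ht.count_pos (ht.le_resume hv)
    have h1 : resume (t', v) = resume (t, v) := by
      rw [ht.resume_eq, ht'.resume_eq, hag 0 hc]
    have h2 : count t' (resume (t, v)) = count t (resume (t, v)) :=
      count_eq_of hlt fun n hn => by
        rw [arr_congr hag hn]
        exact arr_le_of_lt_count hn
    refine ⟨⟨ht', hv⟩, h1, Prod.ext h1 ?_⟩
    simp only [idlePhase, h1, lastArr, h2, hc.ne', if_false]
    exact arr_congr hag (Nat.sub_lt hc one_pos)

/-! ### The service phase of a cycle -/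

/-- A service discipline, given by the duration of the service phase and the time from its beginning
to the last preemption (`0` if there is none), as a function of the interarrival times from the
beginning of the phase on and of the service times. -/
structure IsService (lam mu : ℝ) (σ : (ℕ → ℝ) × (ℕ → ℝ) → ℝ × ℝ) : Prop where
  measurable : Measurable σ
  measurePreserving : MeasurePreserving (fun p => (σ p, residual p.1 (σ p).1))
    ((iidLaw (expMeasure lam)).prod (iidLaw (expMeasure mu)))
    ((((iidLaw (expMeasure lam)).prod (iidLaw (expMeasure mu))).map σ).prod
      (iidLaw (expMeasure lam)))
  law_duration :
    ((iidLaw (expMeasure lam)).prod (iidLaw (expMeasure mu))).map (fun p => (σ p).1) = expMeasure mu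
  ae_bounds : ∀ᵐ p ∂((iidLaw (expMeasure lam)).prod (iidLaw (expMeasure mu))),
    0 < (σ p).1 ∧ 0 ≤ (σ p).2 ∧ (σ p).2 ≤ (σ p).1

/-- Service without preemption. -/
def cbsService (p : (ℕ → ℝ) × (ℕ → ℝ)) : ℝ × ℝ := (p.2 0, 0)

/-- Service with preemption by every arrival. -/
def cbspService (p : (ℕ → ℝ) × (ℕ → ℝ)) : ℝ × ℝ :=
  (∑ i ∈ Finset.range (sInf {j | p.2 j < p.1 j}), p.1 i + p.2 (sInf {j | p.2 j < p.1 j}),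
    ∑ i ∈ Finset.range (sInf {j | p.2 j < p.1 j}), p.1 i)

theorem ae_pos_expMeasure_seq {mu : ℝ} (hmu : 0 < mu) :
    ∀ᵐ h ∂(iidLaw (expMeasure mu)), ∀ i, 0 < h i := by
  have := isProbabilityMeasure_expMeasure hmu
  exact ae_all_iff.2 fun i =>
    (measurePreserving_eval_infinitePi (fun _ : ℕ => expMeasure mu) i).quasiMeasurePreserving.ae
      ae_expMeasure_pos

theorem isService_cbsService {lam mu : ℝ} (hlam : 0 < lam) (hmu : 0 < mu) :
    IsService lam mu cbsService := by
  have := isProbabilityMeasure_expMeasure hlam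
  have := isProbabilityMeasure_expMeasure hmu
  have hpos : ∀ᵐ p ∂((iidLaw (expMeasure lam)).prod (iidLaw (expMeasure mu))), ∀ i, 0 < p.2 i :=
    Measure.quasiMeasurePreserving_snd.ae (ae_pos_expMeasure_seq hmu)
  have hmeas : Measurable cbsService := by unfold cbsService; fun_prop
  refine ⟨hmeas, ?_, ?_, ?_⟩
  · refine strongMarkov hlam _ (fun p => (cbsService p).1) cbsService hmeas.fst hmeas
      {p | Good p.1 ∧ ∀ i, 0 < p.2 i} ?_ ?_ ?_
    · exact (Measure.quasiMeasurePreserving_fst.ae (ae_good hlam)).and hpos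
    · rintro ⟨t, h⟩ ⟨ht, hh⟩
      exact ⟨ht, (hh 0).le⟩
    · rintro t h t' ⟨-, hh⟩ ht' - -
      exact ⟨⟨ht', hh⟩, rfl, rfl⟩
  · exact ((measurePreserving_eval_infinitePi (fun _ : ℕ => expMeasure mu) 0).comp
      measurePreserving_snd).map_eq
  · filter_upwards [hpos] with p hp
    exact ⟨hp 0, le_rfl, (hp 0).le⟩

/-! ### The exponential duration of the service phase with preemption. -/

theorem measurePreserving_prodProdProdComm {α β γ δ : Type*} [MeasurableSpace α]
    [MeasurableSpace β] [MeasurableSpace γ] [MeasurableSpace δ] (μ : Measure α) (ν : Measure β)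
    (ρ : Measure γ) (σ : Measure δ) [SFinite μ] [SFinite ν] [SFinite ρ] [SFinite σ] :
    MeasurePreserving (fun p : (α × β) × (γ × δ) => ((p.1.1, p.2.1), (p.1.2, p.2.2)))
      ((μ.prod ν).prod (ρ.prod σ)) ((μ.prod ρ).prod (ν.prod σ)) := by
  have h1 := measurePreserving_prodAssoc μ ν (ρ.prod σ)
  have h2 := (MeasurePreserving.id μ).prod ((measurePreserving_prodAssoc ν ρ σ).symm _)
  have h3 := (MeasurePreserving.id μ).prod
    ((Measure.measurePreserving_swap (μ := ν) (ν := ρ)).prod (MeasurePreserving.id σ))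
  have h4 := (MeasurePreserving.id μ).prod (measurePreserving_prodAssoc ρ ν σ)
  have h5 := (measurePreserving_prodAssoc μ ρ (ν.prod σ)).symm _
  exact h5.comp (h4.comp (h3.comp (h2.comp h1)))

/-- The duration of the service phase with preemption, when at most `k` preemptions are
permitted. -/
def cappedDuration : ℕ → (ℕ → ℝ) × (ℕ → ℝ) → ℝ
  | 0, p => p.2 0
  | k + 1, p => if p.2 0 < p.1 0 then p.2 0 else
      p.1 0 + cappedDuration k (fun n => p.1 (n + 1), fun n => p.2 (n + 1))

theorem measurable_cappedDuration (k : ℕ) : Measurable (cappedDuration k) := by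
  induction k with
  | zero => exact (by fun_prop : Measurable fun p : (ℕ → ℝ) × (ℕ → ℝ) => p.2 0)
  | succ k ih =>
    refine Measurable.ite (p := fun p : (ℕ → ℝ) × (ℕ → ℝ) => p.2 0 < p.1 0)
      (measurableSet_lt (by fun_prop) (by fun_prop))
      (by fun_prop : Measurable fun p : (ℕ → ℝ) × (ℕ → ℝ) => p.2 0) ?_
    exact (by fun_prop : Measurable fun p : (ℕ → ℝ) × (ℕ → ℝ) => p.1 0).add
      (ih.comp (by fun_prop))

/-- The cap is not felt once it reaches the index `j` of the first uninterrupted service. Hence the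
capped durations are eventually equal to the true one. -/
theorem cappedDuration_eq {j k : ℕ} (hjk : j ≤ k) {t h : ℕ → ℝ} (hlt : ∀ i < j, t i ≤ h i)
    (hj : h j < t j) : cappedDuration k (t, h) = ∑ i ∈ Finset.range j, t i + h j := by
  induction j generalizing k t h with
  | zero =>
    cases k with
    | zero => simp [cappedDuration]
    | succ k => simp [cappedDuration, hj]
  | succ j ih =>
    obtain ⟨k, rfl⟩ : ∃ k', k = k' + 1 := ⟨k - 1, by omega⟩
    rw [cappedDuration, if_neg (by simpa using hlt 0 (by omega)),
      ih (by omega) (fun i hi => hlt (i + 1) (by omega)) hj, Finset.sum_range_succ']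
    simp only
    ring

/-- Let the first arrival come at time `a`. A service shorter than `a` is completed; otherwise the
phase lasts `a` plus, by induction, a fresh exponential time. By memorylessness a service time
conditioned to exceed `a` has exactly this law. -/
theorem map_cappedDuration {lam mu : ℝ} (hlam : 0 < lam) (hmu : 0 < mu) (k : ℕ) :
    ((iidLaw (expMeasure lam)).prod (iidLaw (expMeasure mu))).map (cappedDuration k) =
      expMeasure mu := by
  have := isProbabilityMeasure_expMeasure hlam
  have := isProbabilityMeasure_expMeasure hmu
  have hnoat : ∀ c : ℝ, ∀ᵐ x ∂(expMeasure mu), x ≠ c := fun c =>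
    (withDensity_absolutelyContinuous volume (exponentialPDF mu)).ae_le (show ∀ᵐ x : ℝ, x ≠ c by simp [ae_iff])
  induction k with
  | zero =>
    exact ((measurePreserving_eval_infinitePi (fun _ : ℕ => expMeasure mu) 0).comp
      measurePreserving_snd).map_eq
  | succ k ih =>
    refine Measure.ext_of_lintegral _ fun f hf => ?_
    rw [lintegral_map hf (measurable_cappedDuration _)]
    have hmp := (measurePreserving_prodProdProdComm (expMeasure lam) (iidLaw (expMeasure lam))
      (expMeasure mu) (iidLaw (expMeasure mu))).comp
      ((measurePreserving_head_tail (expMeasure lam)).prod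
        (measurePreserving_head_tail (expMeasure mu)))
    let g : (ℝ × ℝ) × ((ℕ → ℝ) × (ℕ → ℝ)) → ℝ≥0∞ := fun x =>
      if x.1.2 < x.1.1 then f x.1.2 else f (x.1.1 + cappedDuration k x.2)
    have hg : Measurable g := by
      refine Measurable.ite (measurableSet_lt (by fun_prop) (by fun_prop)) (by fun_prop) ?_
      have := measurable_cappedDuration k
      fun_prop
    have e1 : ∀ p, f (cappedDuration (k + 1) p) = g ((p.1 0, p.2 0),
        (fun n => p.1 (n + 1), fun n => p.2 (n + 1))) := by
      intro p
      simp only [cappedDuration, g]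
      split_ifs <;> rfl
    have e2 := hmp.lintegral_comp hg
    simp only [e1]
    refine (e2.trans ?_)
    rw [lintegral_prod _ hg.aemeasurable]
    have e3 : ∀ x : ℝ × ℝ, ∫⁻ y, g (x, y) ∂((iidLaw (expMeasure lam)).prod (iidLaw (expMeasure mu)))
        = if x.2 < x.1 then f x.2 else ∫⁻ y, f (x.1 + y) ∂(expMeasure mu) := by
      intro x
      simp only [g]
      split_ifs
      · simp
      · conv_rhs => rw [← ih]
        rw [lintegral_map (by fun_prop) (measurable_cappedDuration k)]
    simp only [e3]
    have hshift : Measurable fun x : ℝ => ∫⁻ y, f (x + y) ∂(expMeasure mu) :=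
      Measurable.lintegral_prod_right' (f := fun p : ℝ × ℝ => f (p.1 + p.2)) (by fun_prop)
    have hmeas : Measurable fun x : ℝ × ℝ =>
        if x.2 < x.1 then f x.2 else ∫⁻ y, f (x.1 + y) ∂(expMeasure mu) :=
      Measurable.ite (measurableSet_lt (by fun_prop) (by fun_prop)) (by fun_prop)
        (hshift.comp measurable_fst)
    rw [lintegral_prod _ hmeas.aemeasurable]
    -- For a fixed arrival time `a`, both integrals are split at `b = a`, and memorylessness equates
    -- the parts above `a`.
    have e4 : ∀ᵐ a ∂(expMeasure lam), ∫⁻ b, (if b < a then f b else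
        ∫⁻ y, f (a + y) ∂(expMeasure mu)) ∂(expMeasure mu) = ∫⁻ b, f b ∂(expMeasure mu) := by
      filter_upwards [ae_expMeasure_pos] with a ha
      have h1 := lintegral_expMeasure_memoryless hmu ha.le (f := fun y => f (a + y)) (by fun_prop)
      simp only [add_sub_cancel] at h1
      have h2 : ∀ᵐ b ∂(expMeasure mu), (if b < a then f b else
          ∫⁻ y, f (a + y) ∂(expMeasure mu)) = (Set.Iio a).indicator f b +
          (Set.Ioi a).indicator (fun _ => ∫⁻ y, f (a + y) ∂(expMeasure mu)) b := by
        filter_upwards [hnoat a] with b hb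
        rcases lt_or_gt_of_ne hb with h | h
        · simp [h, h.le]
        · simp [h, not_lt.2 h.le]
      have h3 : ∀ᵐ b ∂(expMeasure mu), f b = (Set.Iio a).indicator f b +
          (Set.Ioi a).indicator f b := by
        filter_upwards [hnoat a] with b hb
        rcases lt_or_gt_of_ne hb with h | h
        · simp [h, h.le]
        · simp [h, h.le]
      rw [lintegral_congr_ae h2, lintegral_congr_ae h3,
        lintegral_add_left (hf.indicator measurableSet_Iio),
        lintegral_add_left (hf.indicator measurableSet_Iio),
        lintegral_indicator_const measurableSet_Ioi, mul_comm, ← h1]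
    rw [lintegral_congr_ae e4]
    simp

theorem ae_exists_lt {lam mu : ℝ} (hlam : 0 < lam) (hmu : 0 < mu) :
    ∀ᵐ p ∂((iidLaw (expMeasure lam)).prod (iidLaw (expMeasure mu))), ∃ j, p.2 j < p.1 j := by
  have := isProbabilityMeasure_expMeasure hlam
  have := isProbabilityMeasure_expMeasure hmu
  refine (Measure.ae_prod_iff_ae_ae ?_).2 ?_
  · simp only [Set.ofPred_exists]
    exact MeasurableSet.iUnion fun j => measurableSet_lt (by fun_prop) (by fun_prop)
  · filter_upwards [ae_frequently_mem (expMeasure lam) (measurableSet_Ioi (a := 1))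
      (expMeasure_Ioi_ne_zero hlam 1)] with t ht
    -- Along a subsequence of interarrival times above `1`, the service times are still i.i.d., so
    -- one of them is below `1`.
    obtain ⟨φ, hφ, hφt⟩ := extraction_of_frequently_atTop ht
    have hmp : MeasurePreserving (fun (h : ℕ → ℝ) n => h (φ n)) (iidLaw (expMeasure mu))
        (iidLaw (expMeasure mu)) :=
      ⟨by fun_prop, Measure.map_infinitePi_infinitePi_of_inj hφ.injective⟩
    filter_upwards [hmp.quasiMeasurePreserving.ae (ae_frequently_mem (expMeasure mu)
      (measurableSet_Iio (a := 1)) (expMeasure_Iio_ne_zero hmu one_pos))] with h hh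
    obtain ⟨n, hn⟩ := hh.exists
    exact ⟨φ n, lt_trans hn (hφt n)⟩

theorem isService_cbspService {lam mu : ℝ} (hlam : 0 < lam) (hmu : 0 < mu) :
    IsService lam mu cbspService := by
  have := isProbabilityMeasure_expMeasure hlam
  have := isProbabilityMeasure_expMeasure hmu
  have hae : ∀ᵐ p ∂((iidLaw (expMeasure lam)).prod (iidLaw (expMeasure mu))),
      p ∈ {p : (ℕ → ℝ) × (ℕ → ℝ) | Good p.1 ∧ (∀ i, 0 < p.2 i) ∧ ∃ j, p.2 j < p.1 j} := by
    filter_upwards [Measure.quasiMeasurePreserving_fst.ae (ae_good hlam),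
      Measure.quasiMeasurePreserving_snd.ae (ae_pos_expMeasure_seq hmu), ae_exists_lt hlam hmu]
      with p h1 h2 h3
    exact ⟨h1, h2, h3⟩
  have hN : Measurable fun p : (ℕ → ℝ) × (ℕ → ℝ) => sInf {j | p.2 j < p.1 j} :=
    measurable_sInf_nat fun j => measurableSet_lt (by fun_prop) (by fun_prop)
  have hmeas : Measurable cbspService := by
    unfold cbspService
    have hsum := measurable_apply_nat (f := fun n (p : (ℕ → ℝ) × (ℕ → ℝ)) =>
      ∑ i ∈ Finset.range n, p.1 i) hN fun n => by fun_prop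
    exact (hsum.add (measurable_apply_nat (f := fun n (p : (ℕ → ℝ) × (ℕ → ℝ)) => p.2 n) hN
      fun n => by fun_prop)).prodMk hsum
  refine ⟨hmeas, ?_, ?_, ?_⟩
  · refine strongMarkov hlam _ (fun p => (cbspService p).1) cbspService hmeas.fst hmeas
      {p | Good p.1 ∧ (∀ i, 0 < p.2 i) ∧ ∃ j, p.2 j < p.1 j} hae ?_ ?_
    · rintro ⟨t, h⟩ ⟨ht, hh, -⟩
      exact ⟨ht, add_nonneg (Finset.sum_nonneg fun i _ => (ht.1 i).le) (hh _).le⟩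
    · rintro t h t' ⟨ht, hh, hex⟩ ht' hag hlt
      set N := sInf {j | h j < t j} with hN_def
      have hNlt : h N < t N := Nat.sInf_mem (s := {j | h j < t j}) hex
      have hD : (cbspService (t, h)).1 = ∑ i ∈ Finset.range N, t i + h N := rfl
      -- Every preemption is an arrival and none interrupts the last service, so the arrivals during
      -- the phase are exactly the `N` preemptions. This is what makes its end a stopping time.
      have hcount : count t (cbspService (t, h)).1 = N := by
        rw [hD]
        refine count_eq_of ?_ fun n hn => ?_
        · rw [arr, Finset.sum_range_succ]
          linarith
        · have := Finset.sum_le_sum_of_subset_of_nonneg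
            (Finset.range_mono (Nat.succ_le_of_lt hn)) fun i _ _ => (ht.1 i).le
          exact this.trans (by linarith [hh N])
      rw [hcount] at hag hlt
      have hsum : ∑ i ∈ Finset.range N, t' i = ∑ i ∈ Finset.range N, t i :=
        Finset.sum_congr rfl fun i hi => hag i (Finset.mem_range.1 hi)
      have hNlt' : h N < t' N := by
        rw [hD, arr, Finset.sum_range_succ, hsum] at hlt
        linarith
      have hN' : sInf {j | h j < t' j} = N := by
        refine le_antisymm (Nat.sInf_le hNlt') (not_lt.1 fun hlt' => ?_)
        have h1 := Nat.sInf_mem (s := {j | h j < t' j}) ⟨N, hNlt'⟩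
        simp only [Set.mem_ofPred_eq] at h1
        rw [hag _ hlt'] at h1
        exact absurd (Nat.sInf_le (s := {j | h j < t j}) h1) (not_le.2 hlt')
      have hO : cbspService (t', h) = cbspService (t, h) := by
        simp only [cbspService, hN', hsum, ← hN_def]
      exact ⟨⟨ht', hh, N, hNlt'⟩, by rw [hO], hO⟩
  · ext S hS
    rw [Measure.map_apply hmeas.fst hS]
    -- The capped durations all have the same law and are almost surely eventually equal to the true
    -- duration, which therefore inherits that law.
    refine tendsto_nhds_unique (f := fun _ : ℕ => expMeasure mu S) (l := atTop) ?_
      tendsto_const_nhds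
    have : (fun _ : ℕ => expMeasure mu S) = fun k =>
        ((iidLaw (expMeasure lam)).prod (iidLaw (expMeasure mu))) (cappedDuration k ⁻¹' S) := by
      funext k
      conv_lhs => rw [← map_cappedDuration hlam hmu k]
      rw [Measure.map_apply (measurable_cappedDuration k) hS]
    rw [this]
    refine tendsto_measure_of_ae_tendsto_indicator_of_isFiniteMeasure atTop (hmeas.fst hS)
      (fun k => measurable_cappedDuration k hS) ?_
    filter_upwards [hae] with p hp
    obtain ⟨t, h⟩ := p
    filter_upwards [eventually_ge_atTop (sInf {j | h j < t j})] with k hk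
    have := cappedDuration_eq hk (fun i hi => not_lt.1 (Nat.notMem_of_lt_sInf hi))
      (Nat.sInf_mem (s := {j | h j < t j}) hp.2.2)
    simp only [Set.mem_preimage, this, cbspService]
  · filter_upwards [hae] with p hp
    have h0 : 0 ≤ ∑ i ∈ Finset.range (sInf {j | p.2 j < p.1 j}), p.1 i :=
      Finset.sum_nonneg fun i _ => (hp.1.1 i).le
    have h1 := hp.2.1 (sInf {j | p.2 j < p.1 j})
    simp only [cbspService]
    exact ⟨by linarith, h0, by linarith⟩

/-! ### The cycles of the system -/

/-- The interarrival times, the vacation lengths and the service times seen by the server when it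
leaves for a vacation. -/
abbrev Input : Type := (ℕ → ℝ) × ((ℕ → ℕ → ℝ) × (ℕ → ℕ → ℝ))

/-- The law of the input. -/
abbrev inputLaw (lam mu : ℝ) (ν : Measure ℝ) : Measure Input :=
  (iidLaw (expMeasure lam)).prod ((iidLaw (iidLaw ν)).prod (iidLaw (iidLaw (expMeasure mu))))

/-- The duration of the idle phase, the generation time of the packet that is in the buffer at its
end, and the outcome of the service phase. -/
def cycle (σ : (ℕ → ℝ) × (ℕ → ℝ) → ℝ × ℝ) (e : Input) : (ℝ × ℝ) × (ℝ × ℝ) :=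
  (idlePhase (e.1, e.2.1 0), σ (residual e.1 (resume (e.1, e.2.1 0)), e.2.2 0))

/-- The input seen by the server at the end of the first cycle. -/
def nextInput (σ : (ℕ → ℝ) × (ℕ → ℝ) → ℝ × ℝ) (e : Input) : Input :=
  (residual (residual e.1 (resume (e.1, e.2.1 0))) (cycle σ e).2.1,
    (fun l => e.2.1 (l + 1), fun l => e.2.2 (l + 1)))

/-- The law of the idle phase of a cycle. -/
abbrev idleLaw (lam : ℝ) (ν : Measure ℝ) : Measure (ℝ × ℝ) :=
  ((iidLaw (expMeasure lam)).prod (iidLaw ν)).map idlePhase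

/-- The law of the service phase of a cycle. -/
abbrev serviceLaw (lam mu : ℝ) (σ : (ℕ → ℝ) × (ℕ → ℝ) → ℝ × ℝ) : Measure (ℝ × ℝ) :=
  ((iidLaw (expMeasure lam)).prod (iidLaw (expMeasure mu))).map σ

/-- The Markov property is used twice: at the end of the idle phase (`h4`) and of the service phase
(`h7`). The other maps split off the vacations and services of this cycle and rearrange factors. -/
theorem measurePreserving_cycle_nextInput {lam mu : ℝ} (hlam : 0 < lam) (hmu : 0 < mu)
    (ν : Measure ℝ) [IsProbabilityMeasure ν] (hν : ν (Set.Iio 0) = 0) (hν0 : ν (Set.Ioi 0) ≠ 0)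
    {σ : (ℕ → ℝ) × (ℕ → ℝ) → ℝ × ℝ} (hσ : IsService lam mu σ) :
    MeasurePreserving (fun e => (cycle σ e, nextInput σ e)) (inputLaw lam mu ν)
      (((idleLaw lam ν).prod (serviceLaw lam mu σ)).prod (inputLaw lam mu ν)) := by
  have := isProbabilityMeasure_expMeasure hlam
  have := isProbabilityMeasure_expMeasure hmu
  set π := iidLaw (expMeasure lam)
  set η := iidLaw (expMeasure mu)
  set w := (iidLaw (iidLaw ν)).prod (iidLaw η)
  have hid := MeasurePreserving.id π
  have h1 := hid.prod ((measurePreserving_prodProdProdComm _ _ _ _).comp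
    ((measurePreserving_head_tail (iidLaw ν)).prod (measurePreserving_head_tail η)))
  have h2 := hid.prod (measurePreserving_prodAssoc (iidLaw ν) η w)
  have h3 := (measurePreserving_prodAssoc π (iidLaw ν) (η.prod w)).symm _
  have h4 := (measurePreserving_idlePhase hlam ν hν hν0).prod (MeasurePreserving.id (η.prod w))
  have h5 := measurePreserving_prodAssoc (idleLaw lam ν) π (η.prod w)
  have h6 := (MeasurePreserving.id (idleLaw lam ν)).prod
    ((measurePreserving_prodAssoc π η w).symm _)
  have h7 := (MeasurePreserving.id (idleLaw lam ν)).prod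
    (hσ.measurePreserving.prod (MeasurePreserving.id w))
  have h8 := (MeasurePreserving.id (idleLaw lam ν)).prod
    (measurePreserving_prodAssoc (serviceLaw lam mu σ) π w)
  have h9 := (measurePreserving_prodAssoc (idleLaw lam ν) (serviceLaw lam mu σ) (π.prod w)).symm _
  exact h9.comp (h8.comp (h7.comp (h6.comp (h5.comp (h4.comp (h3.comp (h2.comp h1)))))))

/-! ### From the random data of the model to an i.i.d. sequence of cycles. -/

theorem measurePreserving_split {X ι κ : Type*} [MeasurableSpace X]
    (μ : ι → Measure X) (ν : κ → Measure X) [∀ i, IsProbabilityMeasure (μ i)]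
    [∀ i, IsProbabilityMeasure (ν i)] [∀ i, IsProbabilityMeasure (Sum.elim μ ν i)] :
    MeasurePreserving (fun f : ι ⊕ κ → X => (fun i => f (Sum.inl i), fun i => f (Sum.inr i)))
      (Measure.infinitePi (Sum.elim μ ν)) ((Measure.infinitePi μ).prod (Measure.infinitePi ν)) := by
  refine ⟨by fun_prop, ?_⟩
  rw [← map_sumElim_infinitePi, Measure.map_map (by fun_prop)]
  · exact Measure.map_id
  · refine measurable_pi_iff.2 fun i => ?_
    cases i <;> simp only [Sum.elim_inl, Sum.elim_inr] <;> fun_prop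

/-- The input of the system in terms of the random data of the model. -/
def modelInput {Ω : Type*} (T : ℕ → Ω → ℝ) (H V : ℕ × ℕ → Ω → ℝ) (ω : Ω) : Input :=
  (fun n => T n ω, (fun l j => V (l, j) ω, fun l j => H (l, j) ω))

theorem measurePreserving_modelInput {Ω : Type*} [MeasurableSpace Ω] {P : Measure Ω}
    {lam mu : ℝ} (hlam : 0 < lam) (hmu : 0 < mu)
    {ν : Measure ℝ} [IsProbabilityMeasure ν] {T : ℕ → Ω → ℝ} {H V : ℕ × ℕ → Ω → ℝ}
    (h : IsModel P lam mu ν T H V) :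
    MeasurePreserving (modelInput T H V) P (inputLaw lam mu ν) := by
  have := isProbabilityMeasure_expMeasure hlam
  have := isProbabilityMeasure_expMeasure hmu
  let mh : ℕ × ℕ → Measure ℝ := fun _ => expMeasure mu
  let mv : ℕ × ℕ → Measure ℝ := fun _ => ν
  let mt : ℕ → Measure ℝ := fun _ => expMeasure lam
  have i1 : ∀ i, IsProbabilityMeasure (Sum.elim mh mv i) := by
    rintro (i | i) <;> simp only [Sum.elim_inl, Sum.elim_inr, mh, mv] <;> infer_instance
  have i2 : ∀ i, IsProbabilityMeasure (Sum.elim mt (Sum.elim mh mv) i) := by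
    rintro (i | i)
    · simp only [Sum.elim_inl, mt]; infer_instance
    · exact i1 i
  have hmeas : ∀ i, Measurable (Sum.elim T (Sum.elim H V) i) := by
    rintro (i | i | i)
    exacts [h.measurable_T i, h.measurable_H i, h.measurable_V i]
  have h0 : MeasurePreserving (fun ω i => Sum.elim T (Sum.elim H V) i ω) P
      (Measure.infinitePi (Sum.elim mt (Sum.elim mh mv))) := by
    refine ⟨measurable_pi_iff.2 hmeas, ?_⟩
    rw [h.indep.map_fun_eq_infinitePi_map hmeas]
    congr 1
    funext i
    rcases i with i | i | i
    exacts [h.law_T i, h.law_H i, h.law_V i]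
  have h1 := measurePreserving_split mt (Sum.elim mh mv)
  have h2 := (MeasurePreserving.id (Measure.infinitePi mt)).prod (measurePreserving_split mh mv)
  have h3 := (MeasurePreserving.id (Measure.infinitePi mt)).prod (Measure.measurePreserving_swap
    (μ := Measure.infinitePi mh) (ν := Measure.infinitePi mv))
  have hc : ∀ (m : Measure ℝ) [IsProbabilityMeasure m], MeasurePreserving
      (MeasurableEquiv.curry ℕ ℕ ℝ) (Measure.infinitePi fun _ : ℕ × ℕ => m) (iidLaw (iidLaw m)) :=
    fun m _ => ⟨by fun_prop, Measure.infinitePi_map_curry fun _ _ => m⟩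
  have h4 := (MeasurePreserving.id (Measure.infinitePi mt)).prod
    ((hc ν).prod (hc (expMeasure mu)))
  exact h4.comp (h3.comp (h2.comp (h1.comp h0)))

/-- The successive cycles. -/
def cycles (σ : (ℕ → ℝ) × (ℕ → ℝ) → ℝ × ℝ) (e : Input) (n : ℕ) : (ℝ × ℝ) × (ℝ × ℝ) :=
  cycle σ ((nextInput σ)^[n] e)

section

variable {lam mu : ℝ} {ν : Measure ℝ} {σ : (ℕ → ℝ) × (ℕ → ℝ) → ℝ × ℝ}

theorem isProbabilityMeasure_idleLaw (hlam : 0 < lam) [IsProbabilityMeasure ν] :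
    IsProbabilityMeasure (idleLaw lam ν) := by
  have := isProbabilityMeasure_expMeasure hlam
  exact Measure.isProbabilityMeasure_map measurable_idlePhase.aemeasurable

theorem isProbabilityMeasure_serviceLaw (hlam : 0 < lam) (hmu : 0 < mu)
    (hσ : IsService lam mu σ) : IsProbabilityMeasure (serviceLaw lam mu σ) := by
  have := isProbabilityMeasure_expMeasure hlam
  have := isProbabilityMeasure_expMeasure hmu
  exact Measure.isProbabilityMeasure_map hσ.measurable.aemeasurable

theorem measurePreserving_nextInput (hlam : 0 < lam) (hmu : 0 < mu)
    [IsProbabilityMeasure ν] (hν : ν (Set.Iio 0) = 0) (hν0 : ν (Set.Ioi 0) ≠ 0)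
    (hσ : IsService lam mu σ) :
    MeasurePreserving (nextInput σ) (inputLaw lam mu ν) (inputLaw lam mu ν) := by
  have := isProbabilityMeasure_expMeasure hlam
  have := isProbabilityMeasure_expMeasure hmu
  have := isProbabilityMeasure_idleLaw (ν := ν) hlam
  have := isProbabilityMeasure_serviceLaw hlam hmu hσ
  exact measurePreserving_snd.comp (measurePreserving_cycle_nextInput hlam hmu ν hν hν0 hσ)

theorem measurePreserving_cycles (hlam : 0 < lam) (hmu : 0 < mu)
    [IsProbabilityMeasure ν] (hν : ν (Set.Iio 0) = 0) (hν0 : ν (Set.Ioi 0) ≠ 0)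
    (hσ : IsService lam mu σ) :
    MeasurePreserving (cycles σ) (inputLaw lam mu ν)
      (iidLaw ((idleLaw lam ν).prod (serviceLaw lam mu σ))) := by
  have := isProbabilityMeasure_expMeasure hlam
  have := isProbabilityMeasure_expMeasure hmu
  have := isProbabilityMeasure_idleLaw (ν := ν) hlam
  have := isProbabilityMeasure_serviceLaw hlam hmu hσ
  have hmp := measurePreserving_cycle_nextInput hlam hmu ν hν hν0 hσ
  have hc : Measurable (cycle σ) := measurable_fst.comp hmp.measurable
  have hn : Measurable (nextInput σ) := measurable_snd.comp hmp.measurable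
  exact ⟨measurable_pi_iff.2 fun n => hc.comp (hn.iterate n),
    map_orbit_eq_iidLaw _ _ _ _ hc hn hmp.map_eq⟩

end

/-! ### Age processes with given cycle lengths -/

/-- The end of the `n`-th cycle, when the cycle lengths are `x`. -/
def epoch (x : ℕ → ℝ) (n : ℕ) : ℝ := ∑ i ∈ Finset.range n, x i

/-- The sequence `0, y 0, y 1, …`. -/
def lag (y : ℕ → ℝ) : ℕ → ℝ
  | 0 => 0
  | n + 1 => y n

/-- The generation times of the packets completed at the ends of the cycles, if the packet completed
at the end of the cycle `n` has age `y n` then. -/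
def stamp (x y : ℕ → ℝ) (n : ℕ) : ℝ := epoch x n - lag y n

/-- The age at time `t`, in terms of the number of cycles completed up to time `t`. -/
def cycleAge (x y : ℕ → ℝ) (t : ℝ) : ℝ := lag y (count x t) + (t - epoch x (count x t))

theorem epoch_succ (x : ℕ → ℝ) (n : ℕ) : epoch x (n + 1) = epoch x n + x n :=
  Finset.sum_range_succ x n

theorem arr_eq_epoch (x : ℕ → ℝ) (n : ℕ) : arr x n = epoch x (n + 1) := rfl

theorem Good.epoch_strictMono {x : ℕ → ℝ} (hx : Good x) : StrictMono (epoch x) :=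
  strictMono_nat_of_lt_succ fun n => by rw [epoch_succ]; linarith [hx.1 n]

theorem epoch_count_le (x : ℕ → ℝ) {t : ℝ} (ht : 0 ≤ t) :
    epoch x (count x t) ≤ t := by
  rcases h : count x t with _ | n
  · simpa [epoch] using ht
  · rw [← arr_eq_epoch]
    exact arr_le_of_lt_count (by omega)

theorem Good.lt_epoch_count {x : ℕ → ℝ} (hx : Good x) (t : ℝ) : t < epoch x (count x t + 1) :=
  hx.lt_arr_count t

theorem Good.count_eq {x : ℕ → ℝ} (hx : Good x) {t : ℝ} {n : ℕ} (h1 : epoch x n ≤ t)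
    (h2 : t < epoch x (n + 1)) : count x t = n :=
  count_eq_of h2 fun m hm => by
    rw [arr_eq_epoch]
    exact (hx.epoch_strictMono.monotone (by omega)).trans h1

theorem Good.tendsto_count {x : ℕ → ℝ} (hx : Good x) : Tendsto (count x) atTop atTop :=
  tendsto_atTop.2 fun n => (eventually_ge_atTop (arr x n)).mono fun _ ht =>
    (hx.lt_count_iff.2 ht).le

/-- The ages at the ends of the cycles are nonnegative, and at most the lengths of the cycles. -/
def Fresh (x y : ℕ → ℝ) : Prop := ∀ i, 0 ≤ y i ∧ y i ≤ x i

theorem Fresh.lag_nonneg {x y : ℕ → ℝ} (h : Fresh x y) (n : ℕ) : 0 ≤ lag y n := by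
  cases n
  exacts [le_rfl, (h _).1]

/-- A packet completed in a cycle is generated no earlier than the start of that cycle, hence no
earlier than the previously completed one. So the freshest completed packet is the latest completed
one. -/
theorem stamp_monotone {x y : ℕ → ℝ} (h : Fresh x y) : Monotone (stamp x y) :=
  monotone_nat_of_le_succ fun n => by
    have h1 := h.lag_nonneg n
    have h2 := (h n).2
    have h3 : stamp x y (n + 1) = epoch x n + x n - y n := by rw [stamp, epoch_succ]; rfl
    rw [h3, stamp]
    linarith

theorem age_eq_cycleAge {x y : ℕ → ℝ} (hx : Good x) (h : Fresh x y) {t : ℝ} (ht : 0 ≤ t) :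
    age (epoch x) (stamp x y) t = cycleAge x y t := by
  have : IsGreatest {s | ∃ l, s = stamp x y l ∧ epoch x l ≤ t} (stamp x y (count x t)) := by
    refine ⟨⟨_, rfl, epoch_count_le x ht⟩, ?_⟩
    rintro s ⟨l, rfl, hl⟩
    refine stamp_monotone h (not_lt.1 fun hlt => ?_)
    have := hx.epoch_strictMono.monotone (Nat.succ_le_of_lt hlt)
    exact absurd (hx.lt_epoch_count t) (not_lt.2 (this.trans hl))
  rw [age, this.csSup_eq, stamp, cycleAge]
  ring

theorem peakAge_epoch_stamp (x y : ℕ → ℝ) (n : ℕ) :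
    peakAge (epoch x) (stamp x y) n = x n + lag y n := by
  rw [peakAge, stamp, epoch_succ]
  ring

/-- The integral of the age over the `i`-th cycle. -/
def cycleCost (x y : ℕ → ℝ) (i : ℕ) : ℝ := lag y i * x i + x i ^ 2 / 2

theorem lintegral_affine {a b c : ℝ} (hab : a ≤ b) (hc : 0 ≤ c) :
    ∫⁻ t in Set.Ioc a b, ENNReal.ofReal (c + (t - a)) =
      ENNReal.ofReal (c * (b - a) + (b - a) ^ 2 / 2) := by
  rw [← ofReal_integral_eq_lintegral_ofReal, ← intervalIntegral.integral_of_le hab]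
  · congr 1
    rw [intervalIntegral.integral_add (by simp) (Continuous.intervalIntegrable (by fun_prop) _ _),
      intervalIntegral.integral_sub (Continuous.intervalIntegrable (by fun_prop) _ _) (by simp),
      integral_id]
    simp
    ring
  · exact (Continuous.integrableOn_Icc (by fun_prop)).mono_set Set.Ioc_subset_Icc_self
  · refine (ae_restrict_mem measurableSet_Ioc).mono fun t ht => ?_
    have := ht.1
    simp only [Pi.zero_apply]
    linarith

theorem lintegral_age_epoch {x y : ℕ → ℝ} (hx : Good x) (h : Fresh x y) (n : ℕ) :
    (∀ τ, epoch x n ≤ τ → τ ≤ epoch x (n + 1) →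
      ∫⁻ t in Set.Ioc (epoch x n) τ, ENNReal.ofReal (age (epoch x) (stamp x y) t) =
        ENNReal.ofReal (lag y n * (τ - epoch x n) + (τ - epoch x n) ^ 2 / 2)) := by
  intro τ h1 h2
  have h0 : 0 ≤ epoch x n := Finset.sum_nonneg fun i _ => (hx.1 i).le
  -- The right endpoint is dropped because the age may jump there: the next cycle has begun if `τ`
  -- is an epoch.
  rw [← lintegral_affine h1 (h.lag_nonneg n), ← restrict_Ioo_eq_restrict_Ioc]
  refine setLIntegral_congr_fun measurableSet_Ioo fun t ht => ?_
  rw [age_eq_cycleAge hx h (h0.trans ht.1.le), cycleAge,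
    hx.count_eq ht.1.le (ht.2.trans_le h2)]

theorem cycleCost_nonneg {x y : ℕ → ℝ} (hx : Good x) (h : Fresh x y) (i : ℕ) :
    0 ≤ cycleCost x y i := by
  have := mul_nonneg (h.lag_nonneg i) (hx.1 i).le
  unfold cycleCost
  positivity

theorem lintegral_age {x y : ℕ → ℝ} (hx : Good x) (h : Fresh x y) (n : ℕ) {τ : ℝ}
    (h1 : epoch x n ≤ τ) (h2 : τ ≤ epoch x (n + 1)) :
    ∫⁻ t in Set.Ioc 0 τ, ENNReal.ofReal (age (epoch x) (stamp x y) t) =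
      ENNReal.ofReal (∑ i ∈ Finset.range n, cycleCost x y i +
        (lag y n * (τ - epoch x n) + (τ - epoch x n) ^ 2 / 2)) := by
  have h0 : ∀ n, 0 ≤ epoch x n := fun n => Finset.sum_nonneg fun i _ => (hx.1 i).le
  have hF : ∀ n, 0 ≤ ∑ i ∈ Finset.range n, cycleCost x y i := fun n =>
    Finset.sum_nonneg fun i _ => cycleCost_nonneg hx h i
  have hrest : 0 ≤ lag y n * (τ - epoch x n) + (τ - epoch x n) ^ 2 / 2 := by
    have := mul_nonneg (h.lag_nonneg n) (sub_nonneg.2 h1)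
    positivity
  have hfull : ∀ n, ∫⁻ t in Set.Ioc 0 (epoch x n),
      ENNReal.ofReal (age (epoch x) (stamp x y) t) =
        ENNReal.ofReal (∑ i ∈ Finset.range n, cycleCost x y i) := by
    intro n
    induction n with
    | zero => simp [epoch]
    | succ n ih =>
      have hle : epoch x n ≤ epoch x (n + 1) := hx.epoch_strictMono.monotone n.le_succ
      rw [← Set.Ioc_union_Ioc_eq_Ioc (h0 n) hle,
        lintegral_union measurableSet_Ioc (Set.Ioc_disjoint_Ioc_of_le le_rfl), ih,
        lintegral_age_epoch hx h n _ hle le_rfl, Finset.sum_range_succ,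
        ENNReal.ofReal_add (hF n) (cycleCost_nonneg hx h n), epoch_succ, add_sub_cancel_left]
      rfl
  rw [← Set.Ioc_union_Ioc_eq_Ioc (h0 n) h1,
    lintegral_union measurableSet_Ioc (Set.Ioc_disjoint_Ioc_of_le le_rfl), hfull,
    lintegral_age_epoch hx h n _ h1 h2, ENNReal.ofReal_add (hF n) hrest]

/-- The running cycle is left out of the cost and counted in full in the time for the lower bound,
and the other way round for the upper bound. -/
theorem timeAverage_bounds {x y : ℕ → ℝ} (hx : Good x) (h : Fresh x y) {τ : ℝ} (hτ : 0 < τ) :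
    (∑ i ∈ Finset.range (count x τ), ENNReal.ofReal (cycleCost x y i)) /
        (∑ i ∈ Finset.range (count x τ + 1), ENNReal.ofReal (x i)) ≤
      timeAverage (age (epoch x) (stamp x y)) τ ∧
    timeAverage (age (epoch x) (stamp x y)) τ ≤
      (∑ i ∈ Finset.range (count x τ + 1), ENNReal.ofReal (cycleCost x y i)) /
        (∑ i ∈ Finset.range (count x τ), ENNReal.ofReal (x i)) := by
  set n := count x τ with hn
  have h1 : epoch x n ≤ τ := epoch_count_le x hτ.le
  have h2 : τ < epoch x (n + 1) := hx.lt_epoch_count τ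
  have hC : ∀ n, ∑ i ∈ Finset.range n, ENNReal.ofReal (x i) = ENNReal.ofReal (epoch x n) :=
    fun n => (ENNReal.ofReal_sum_of_nonneg fun i _ => (hx.1 i).le).symm
  have hF : ∀ n, ∑ i ∈ Finset.range n, ENNReal.ofReal (cycleCost x y i) =
      ENNReal.ofReal (∑ i ∈ Finset.range n, cycleCost x y i) :=
    fun n => (ENNReal.ofReal_sum_of_nonneg fun i _ => cycleCost_nonneg hx h i).symm
  have hu : τ - epoch x n ≤ x n := by rw [epoch_succ] at h2; linarith
  have hu0 : 0 ≤ τ - epoch x n := sub_nonneg.2 h1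
  have hl := h.lag_nonneg n
  rw [hC, hC, hF, hF, timeAverage, lintegral_age hx h n h1 h2.le]
  constructor
  · refine ENNReal.div_le_div (ENNReal.ofReal_le_ofReal ?_) (ENNReal.ofReal_le_ofReal h2.le)
    have := mul_nonneg hl hu0
    nlinarith
  · refine ENNReal.div_le_div (ENNReal.ofReal_le_ofReal ?_) (ENNReal.ofReal_le_ofReal h1)
    rw [Finset.sum_range_succ, cycleCost]
    gcongr

/-- Each cycle costs at least `x² / 2 ≥ M * x - M² / 2`. The linear terms add up to `M * τ`, so the
bound is useful when cycles are rare, which is the case of infinite mean length. -/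
theorem le_timeAverage {x y : ℕ → ℝ} (hx : Good x) (h : Fresh x y) {τ : ℝ} (hτ : 0 < τ) (M : ℝ) :
    ENNReal.ofReal (M - (count x τ + 1) * (M ^ 2 / 2) / τ) ≤
      timeAverage (age (epoch x) (stamp x y)) τ := by
  set n := count x τ with hn
  have h1 : epoch x n ≤ τ := epoch_count_le x hτ.le
  have h2 : τ < epoch x (n + 1) := hx.lt_epoch_count τ
  rw [timeAverage, lintegral_age hx h n h1 h2.le, ← ENNReal.ofReal_div_of_pos hτ]
  refine ENNReal.ofReal_le_ofReal ?_
  rw [le_div_iff₀ hτ, sub_mul, div_mul_cancel₀ _ hτ.ne']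
  have hs : ∑ i ∈ Finset.range n, (M * x i - M ^ 2 / 2) ≤
      ∑ i ∈ Finset.range n, cycleCost x y i := Finset.sum_le_sum fun i _ => by
    have := mul_nonneg (h.lag_nonneg i) (hx.1 i).le
    unfold cycleCost
    nlinarith [sq_nonneg (x i - M)]
  rw [Finset.sum_sub_distrib, ← Finset.mul_sum, Finset.sum_const, Finset.card_range,
    nsmul_eq_mul] at hs
  have hu := mul_nonneg (h.lag_nonneg n) (sub_nonneg.2 h1)
  have he : epoch x n = ∑ i ∈ Finset.range n, x i := rfl
  rw [← he] at hs
  nlinarith [sq_nonneg (τ - epoch x n - M)]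

theorem tendsto_natCast_div_succ :
    Tendsto (fun n : ℕ => (n : ℝ≥0∞) / ((n + 1 : ℕ) : ℝ≥0∞)) atTop (𝓝 1) := by
  have := ENNReal.tendsto_ofReal (tendsto_natCast_div_add_atTop (1 : ℝ))
  rw [ENNReal.ofReal_one] at this
  refine this.congr fun n => ?_
  rw [ENNReal.ofReal_div_of_pos (by positivity), ENNReal.ofReal_natCast]
  norm_cast

theorem tendsto_div_succ_of_average {u : ℕ → ℝ≥0∞} {w : ℝ≥0∞}
    (hu : Tendsto (fun n : ℕ => u n / n) atTop (𝓝 w)) :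
    Tendsto (fun n : ℕ => u n / ((n + 1 : ℕ) : ℝ≥0∞)) atTop (𝓝 w) := by
  have := ENNReal.Tendsto.mul hu (Or.inr ENNReal.one_ne_top) tendsto_natCast_div_succ
    (Or.inl one_ne_zero)
  rw [mul_one] at this
  refine this.congr' ((eventually_ge_atTop 1).mono fun n hn => ?_)
  have hn0 : (n : ℝ≥0∞) ≠ 0 := by simp; omega
  rw [← mul_div_assoc, ENNReal.div_mul_cancel hn0 (ENNReal.natCast_ne_top n)]

theorem ennreal_div_div_div_cancel (a b : ℝ≥0∞) {c : ℝ≥0∞} (h0 : c ≠ 0) (ht : c ≠ ⊤) :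
    a / c / (b / c) = a / b := by
  rw [div_eq_mul_inv a c, div_eq_mul_inv b c]
  exact ENNReal.mul_div_mul_right _ _ (ENNReal.inv_ne_zero.2 ht) (ENNReal.inv_ne_top.2 h0)

theorem tendsto_timeAverage {x y : ℕ → ℝ} (hx : Good x) (h : Fresh x y) {w m : ℝ≥0∞}
    (hm0 : m ≠ 0) (hm : m ≠ ⊤)
    (hX : Tendsto (fun n : ℕ => (∑ i ∈ Finset.range n, ENNReal.ofReal (x i)) / n) atTop (𝓝 m))
    (hW : Tendsto (fun n : ℕ => (∑ i ∈ Finset.range n, ENNReal.ofReal (cycleCost x y i)) / n)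
      atTop (𝓝 w)) :
    Tendsto (timeAverage (age (epoch x) (stamp x y))) atTop (𝓝 (w / m)) := by
  have hcast : ∀ n : ℕ, ((n + 1 : ℕ) : ℝ≥0∞) ≠ 0 := fun n => by simp
  have hlow := ENNReal.Tendsto.div (tendsto_div_succ_of_average hW) (Or.inr hm0)
    (hX.comp (tendsto_add_atTop_nat 1)) (Or.inl hm)
  have hup := ENNReal.Tendsto.div (hW.comp (tendsto_add_atTop_nat 1)) (Or.inr hm0)
    (tendsto_div_succ_of_average hX) (Or.inl hm)
  simp only [Function.comp_def, ennreal_div_div_div_cancel _ _ (hcast _) (ENNReal.natCast_ne_top _)]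
    at hlow hup
  refine tendsto_of_tendsto_of_tendsto_of_le_of_le' (hlow.comp hx.tendsto_count)
    (hup.comp hx.tendsto_count) ?_ ?_
  · exact (eventually_gt_atTop 0).mono fun τ hτ => (timeAverage_bounds hx h hτ).1
  · exact (eventually_gt_atTop 0).mono fun τ hτ => (timeAverage_bounds hx h hτ).2

theorem tendsto_timeAverage_top {x y : ℕ → ℝ} (hx : Good x) (h : Fresh x y)
    (hX : Tendsto (fun n : ℕ => (∑ i ∈ Finset.range n, ENNReal.ofReal (x i)) / n) atTop (𝓝 ⊤)) :
    Tendsto (timeAverage (age (epoch x) (stamp x y))) atTop (𝓝 ⊤) := by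
  refine ENNReal.tendsto_nhds_top_iff_nat.2 fun K => ?_
  -- Once the mean cycle length exceeds `M ^ 2`, the correction in `le_timeAverage` is at most `1`,
  -- and `M - 1` still exceeds `K`.
  set M : ℝ := K + 2 with hM
  have hMpos : 0 < M := by positivity
  have hev := ENNReal.tendsto_nhds_top_iff_nat.1 hX ((K + 2) ^ 2)
  filter_upwards [hx.tendsto_count.eventually hev, hx.tendsto_count.eventually_ge_atTop 1,
    eventually_gt_atTop 0] with τ h1 h2 hτ
  refine lt_of_lt_of_le ?_ (le_timeAverage hx h hτ M)
  rw [← ENNReal.ofReal_sum_of_nonneg fun i _ => (hx.1 i).le, ENNReal.lt_div_iff_mul_lt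
    (Or.inl (by simp; omega)) (Or.inl (ENNReal.natCast_ne_top _)), ← Nat.cast_mul,
    ← ENNReal.ofReal_natCast, ENNReal.ofReal_lt_ofReal_iff_of_nonneg (by positivity)] at h1
  have h3 : M ^ 2 * count x τ < τ := by
    have := epoch_count_le x hτ.le
    push_cast at h1
    exact lt_of_lt_of_le h1 this
  have h4 : ((count x τ : ℝ) + 1) * (M ^ 2 / 2) / τ ≤ 1 := by
    rw [div_le_one hτ]
    have : (1 : ℝ) ≤ count x τ := by exact_mod_cast h2
    nlinarith [sq_nonneg M]
  rw [← ENNReal.ofReal_natCast, ENNReal.ofReal_lt_ofReal_iff_of_nonneg (by positivity)]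
  linarith

theorem tendsto_average_lag {y : ℕ → ℝ} {f : ℝ → ℝ≥0∞} {w : ℝ≥0∞}
    (hf : f 0 = 0)
    (hy : Tendsto (fun n : ℕ => (∑ i ∈ Finset.range n, f (y i)) / n) atTop (𝓝 w)) :
    Tendsto (fun n : ℕ => (∑ i ∈ Finset.range n, f (lag y i)) / n) atTop (𝓝 w) := by
  rw [← tendsto_add_atTop_iff_nat 1]
  refine (tendsto_div_succ_of_average hy).congr fun n => ?_
  rw [Finset.sum_range_succ']
  simp [lag, hf]

theorem measurable_cycleAge (t : ℝ) :
    Measurable fun p : (ℕ → ℝ) × (ℕ → ℝ) => cycleAge p.1 p.2 t := by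
  refine measurable_apply_nat (f := fun n (p : (ℕ → ℝ) × (ℕ → ℝ)) =>
    lag p.2 n + (t - epoch p.1 n)) (measurable_count measurable_fst measurable_const) fun n => ?_
  have : Measurable fun p : (ℕ → ℝ) × (ℕ → ℝ) => lag p.2 n := by
    cases n <;> simp only [lag] <;> fun_prop
  unfold epoch
  fun_prop

/-! ### Laws of large numbers -/

/-- The strong law of large numbers for nonnegative variables, whose mean may be infinite. -/
theorem strongLaw_nonneg {Ω : Type*} [MeasurableSpace Ω] {P : Measure Ω} [IsProbabilityMeasure P]
    (X : ℕ → Ω → ℝ) (hmeas : ∀ i, Measurable (X i)) (hnn : ∀ i, ∀ᵐ ω ∂P, 0 ≤ X i ω)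
    (hind : Pairwise fun i j => IndepFun (X i) (X j) P)
    (hident : ∀ i, IdentDistrib (X i) (X 0) P P) :
    ∀ᵐ ω ∂P, Tendsto (fun n : ℕ => (∑ i ∈ Finset.range n, ENNReal.ofReal (X i ω)) / n) atTop
      (𝓝 (∫⁻ ω, ENNReal.ofReal (X 0 ω) ∂P)) := by
  have hcast : ∀ {ω} (Y : ℕ → Ω → ℝ), (∀ i, 0 ≤ Y i ω) → ∀ n : ℕ, 1 ≤ n →
      ENNReal.ofReal ((∑ i ∈ Finset.range n, Y i ω) / n) =
        (∑ i ∈ Finset.range n, ENNReal.ofReal (Y i ω)) / n := by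
    intro ω Y hY n hn
    rw [ENNReal.ofReal_div_of_pos (by exact_mod_cast hn),
      ENNReal.ofReal_sum_of_nonneg fun i _ => hY i, ENNReal.ofReal_natCast]
  have hfin : ∀ Y : ℕ → Ω → ℝ, Integrable (Y 0) P → (∀ᵐ ω ∂P, ∀ i, 0 ≤ Y i ω) →
      (Pairwise fun i j => IndepFun (Y i) (Y j) P) → (∀ i, IdentDistrib (Y i) (Y 0) P P) →
      ∀ᵐ ω ∂P, Tendsto (fun n : ℕ => (∑ i ∈ Finset.range n, ENNReal.ofReal (Y i ω)) / n) atTop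
        (𝓝 (∫⁻ ω, ENNReal.ofReal (Y 0 ω) ∂P)) := by
    intro Y hint hY hi hid
    filter_upwards [strong_law_ae_real Y hint hi hid, hY] with ω h1 h2
    rw [← ofReal_integral_eq_lintegral_ofReal hint (hY.mono fun ω h => h 0)]
    refine (ENNReal.tendsto_ofReal h1).congr' ((eventually_ge_atTop 1).mono fun n hn => ?_)
    exact hcast Y h2 n hn
  have hnn' := ae_all_iff.2 hnn
  by_cases hE : ∫⁻ ω, ENNReal.ofReal (X 0 ω) ∂P = ⊤
  · rw [hE]
    -- For an infinite mean, the averages dominate those of the variables truncated at `M`, whose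
    -- limits grow to infinity with `M`.
    have htr : ∀ M : ℕ, ∀ᵐ ω ∂P, Tendsto (fun n : ℕ =>
        (∑ i ∈ Finset.range n, ENNReal.ofReal (min (X i ω) M)) / n) atTop
        (𝓝 (∫⁻ ω, ENNReal.ofReal (min (X 0 ω) M) ∂P)) := by
      intro M
      have hg : Measurable fun x : ℝ => min x (M : ℝ) := by fun_prop
      refine hfin (fun i ω => min (X i ω) M) ?_ ?_ ?_ ?_
      · refine Integrable.of_bound (hg.comp (hmeas 0)).aestronglyMeasurable M ?_
        filter_upwards [hnn'] with ω h
        rw [Real.norm_eq_abs, abs_of_nonneg (le_min (h 0) (Nat.cast_nonneg M))]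
        exact min_le_right _ _
      · filter_upwards [hnn'] with ω h i
        exact le_min (h i) (Nat.cast_nonneg M)
      · exact fun i j hij => (hind hij).comp hg hg
      · exact fun i => (hident i).comp hg
    have hlim : Tendsto (fun M : ℕ => ∫⁻ ω, ENNReal.ofReal (min (X 0 ω) M) ∂P) atTop (𝓝 ⊤) := by
      rw [← hE]
      refine lintegral_tendsto_of_tendsto_of_monotone
        (fun M => ((hmeas 0).min measurable_const).ennreal_ofReal.aemeasurable)
        (ae_of_all _ fun ω M N hMN => ENNReal.ofReal_le_ofReal
          (min_le_min le_rfl (by exact_mod_cast hMN))) (ae_of_all _ fun ω => ?_)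
      refine tendsto_const_nhds.congr' ?_
      obtain ⟨N, hN⟩ := exists_nat_ge (X 0 ω)
      filter_upwards [eventually_ge_atTop N] with M hM
      rw [min_eq_left (hN.trans (by exact_mod_cast hM))]
    filter_upwards [ae_all_iff.2 htr] with ω h
    refine ENNReal.tendsto_nhds_top_iff_nat.2 fun K => ?_
    obtain ⟨M, hM⟩ := (hlim.eventually (lt_mem_nhds (ENNReal.natCast_lt_top K))).exists
    filter_upwards [(h M).eventually (lt_mem_nhds hM)] with n hn
    refine hn.trans_le (ENNReal.div_le_div_right (Finset.sum_le_sum fun i _ => ?_) _)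
    exact ENNReal.ofReal_le_ofReal (min_le_left _ _)
  · refine hfin X ?_ hnn' hind hident
    refine ⟨(hmeas 0).aestronglyMeasurable, ?_⟩
    rw [hasFiniteIntegral_iff_ofReal (hnn 0)]
    exact lt_top_iff_ne_top.2 hE

theorem sum_range_eq_even_add_odd (f : ℕ → ℝ≥0∞) (N : ℕ) :
    ∑ i ∈ Finset.range N, f i = ∑ k ∈ Finset.range ((N + 1) / 2), f (2 * k) +
      ∑ k ∈ Finset.range (N / 2), f (2 * k + 1) := by
  induction N with
  | zero => simp
  | succ N ih =>
    rw [Finset.sum_range_succ, ih]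
    rcases Nat.even_or_odd' N with ⟨m, rfl | rfl⟩
    · rw [show (2 * m + 1 + 1) / 2 = m + 1 by omega, show (2 * m + 1) / 2 = m by omega,
        show (2 * m) / 2 = m by omega, Finset.sum_range_succ]
      ring
    · rw [show (2 * m + 1 + 1 + 1) / 2 = m + 1 by omega, show (2 * m + 1 + 1) / 2 = m + 1 by omega,
        show (2 * m + 1) / 2 = m by omega, Finset.sum_range_succ (fun k => f (2 * k + 1))]
      ring

theorem tendsto_average_of_even_odd {f : ℕ → ℝ≥0∞} {w : ℝ≥0∞}
    (h0 : Tendsto (fun n : ℕ => (∑ k ∈ Finset.range n, f (2 * k)) / n) atTop (𝓝 w))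
    (h1 : Tendsto (fun n : ℕ => (∑ k ∈ Finset.range n, f (2 * k + 1)) / n) atTop (𝓝 w)) :
    Tendsto (fun n : ℕ => (∑ i ∈ Finset.range n, f i) / n) atTop (𝓝 w) := by
  have half : ∀ (a : ℕ → ℕ), (∀ n, n ≤ 2 * a n + 1 ∧ 2 * a n ≤ n + 1) →
      Tendsto (fun n : ℕ => (a n : ℝ≥0∞) / n) atTop (𝓝 2⁻¹) ∧ Tendsto a atTop atTop := by
    intro a ha
    constructor
    · have hreal : Tendsto (fun n : ℕ => (a n : ℝ) / n) atTop (𝓝 2⁻¹) := by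
        have hz := tendsto_one_div_atTop_nhds_zero_nat (𝕜 := ℝ)
        refine tendsto_of_tendsto_of_tendsto_of_le_of_le'
          (g := fun n : ℕ => 2⁻¹ - 2⁻¹ * (1 / (n : ℝ))) (h := fun n : ℕ => 2⁻¹ + 2⁻¹ * (1 / (n : ℝ)))
          (by simpa using (hz.const_mul 2⁻¹).const_sub 2⁻¹)
          (by simpa using (hz.const_mul 2⁻¹).const_add 2⁻¹) ?_ ?_
        all_goals
          filter_upwards [eventually_ge_atTop 1] with n hn
          have hn' : (0 : ℝ) < n := by exact_mod_cast hn
          have e1 : (n : ℝ) ≤ 2 * a n + 1 := by exact_mod_cast (ha n).1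
          have e2 : 2 * (a n : ℝ) ≤ n + 1 := by exact_mod_cast (ha n).2
        · rw [le_div_iff₀ hn']
          have : (2⁻¹ - 2⁻¹ * (1 / (n : ℝ))) * n = 2⁻¹ * n - 2⁻¹ := by field_simp
          rw [this]
          linarith
        · rw [div_le_iff₀ hn']
          have : (2⁻¹ + 2⁻¹ * (1 / (n : ℝ))) * n = 2⁻¹ * n + 2⁻¹ := by field_simp
          rw [this]
          linarith
      have := ENNReal.tendsto_ofReal hreal
      rw [ENNReal.ofReal_inv_of_pos two_pos, ENNReal.ofReal_ofNat] at this
      refine this.congr' ((eventually_ge_atTop 1).mono fun n hn => ?_)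
      rw [ENNReal.ofReal_div_of_pos (by exact_mod_cast hn), ENNReal.ofReal_natCast,
        ENNReal.ofReal_natCast]
    · exact tendsto_atTop.2 fun m => (eventually_ge_atTop (2 * m + 1)).mono fun n hn => by
        have := (ha n).1
        omega
  have part : ∀ (g : ℕ → ℝ≥0∞) (a : ℕ → ℕ), (∀ n, n ≤ 2 * a n + 1 ∧ 2 * a n ≤ n + 1) →
      Tendsto (fun n : ℕ => (∑ k ∈ Finset.range n, g k) / n) atTop (𝓝 w) →
      Tendsto (fun n : ℕ => (∑ k ∈ Finset.range (a n), g k) / n) atTop (𝓝 (w * 2⁻¹)) := by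
    intro g a ha hg
    obtain ⟨t1, t2⟩ := half a ha
    refine (ENNReal.Tendsto.mul (hg.comp t2) (Or.inr (by simp)) t1 (Or.inl (by simp))).congr'
      ((t2.eventually_ge_atTop 1).mono fun n hn => ?_)
    have hn0 : (a n : ℝ≥0∞) ≠ 0 := by simp; omega
    simp only [Function.comp]
    rw [← mul_div_assoc, ENNReal.div_mul_cancel hn0 (ENNReal.natCast_ne_top _)]
  have := (part _ (fun n => (n + 1) / 2) (fun n => by omega) h0).add
    (part _ (fun n => n / 2) (fun n => by omega) h1)
  rw [← mul_add, ENNReal.inv_two_add_inv_two, mul_one] at this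
  refine this.congr fun n => ?_
  rw [← ENNReal.add_div, ← sum_range_eq_even_add_odd]

/-! ### Renewal reward theorems -/

/-- The mean length of a cycle. -/
def meanLength (ρ : Measure (ℝ × ℝ)) : ℝ≥0∞ := ∫⁻ p, ENNReal.ofReal p.1 ∂ρ

/-- The mean age of a packet at its completion. -/
def meanDelay (ρ : Measure (ℝ × ℝ)) : ℝ≥0∞ := ∫⁻ p, ENNReal.ofReal p.2 ∂ρ

/-- The time average of the age, when the pairs of the length of a cycle and the age of the packet
completed at its end are independent with law `ρ`. -/
def meanAge (ρ : Measure (ℝ × ℝ)) : ℝ≥0∞ :=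
  if meanLength ρ = ⊤ then ⊤ else
    (meanDelay ρ * meanLength ρ + ∫⁻ p, ENNReal.ofReal (p.1 ^ 2 / 2) ∂ρ) / meanLength ρ

/-- The cycles with law `ρ` have positive lengths, and packets generated within the cycle. -/
def IsCycleLaw (ρ : Measure (ℝ × ℝ)) : Prop := ∀ᵐ p ∂ρ, 0 < p.1 ∧ 0 ≤ p.2 ∧ p.2 ≤ p.1

section

variable {ρ : Measure (ℝ × ℝ)} [IsProbabilityMeasure ρ]

theorem iIndepFun_eval_iidLaw : iIndepFun (fun i (z : ℕ → ℝ × ℝ) => z i) (iidLaw ρ) :=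
  iIndepFun_infinitePi (P := fun _ : ℕ => ρ) (X := fun _ => id) fun _ => measurable_id

theorem map_eval_pair_iidLaw {i j : ℕ} (hij : i ≠ j) :
    (iidLaw ρ).map (fun z => (z i, z j)) = ρ.prod ρ := by
  rw [(indepFun_iff_map_prod_eq_prod_map_map (measurable_pi_apply i).aemeasurable
    (measurable_pi_apply j).aemeasurable).1 (iIndepFun_eval_iidLaw.indepFun hij), Measure.infinitePi_map_eval,
    Measure.infinitePi_map_eval]

/-- Cycle lengths are i.i.d. and positive, so their sums diverge by the argument already given for
vacations. -/
theorem ae_good_fresh (hρ : IsCycleLaw ρ) : ∀ᵐ z ∂(iidLaw ρ),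
    Good (fun i => (z i).1) ∧ Fresh (fun i => (z i).1) (fun i => (z i).2) := by
  have hall : ∀ᵐ z ∂(iidLaw ρ), ∀ i, 0 < (z i).1 ∧ 0 ≤ (z i).2 ∧ (z i).2 ≤ (z i).1 :=
    ae_all_iff.2 fun i =>
      (measurePreserving_eval_infinitePi (fun _ : ℕ => ρ) i).quasiMeasurePreserving.ae hρ
  have := Measure.isProbabilityMeasure_map (μ := ρ) (f := Prod.fst) (by fun_prop)
  have hmp : MeasurePreserving (fun (z : ℕ → ℝ × ℝ) i => (z i).1) (iidLaw ρ)
      (iidLaw (ρ.map Prod.fst)) :=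
    ⟨by fun_prop, Measure.infinitePi_map_pi (fun _ : ℕ => ρ) fun _ => measurable_fst⟩
  have hpos : ∀ᵐ x ∂(ρ.map Prod.fst), 0 < x :=
    (ae_map_iff (by fun_prop) measurableSet_Ioi).2 (hρ.mono fun p hp => hp.1)
  have h1 : ρ.map Prod.fst (Set.Iio 0) = 0 :=
    measure_mono_null (fun x (hx : x < 0) => not_lt.2 hx.le) hpos
  have h2 : ρ.map Prod.fst (Set.Ioi 0) ≠ 0 := by
    rw [(prob_compl_eq_zero_iff measurableSet_Ioi).1 hpos]
    exact one_ne_zero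
  filter_upwards [hall, hmp.quasiMeasurePreserving.ae (ae_goodVacations _ h1 h2)] with z hz hv
  exact ⟨⟨fun i => (hz i).1, hv.2⟩, fun i => (hz i).2⟩

theorem ae_tendsto_average_eval {g : ℝ × ℝ → ℝ} (hg : Measurable g) (hnn : ∀ᵐ p ∂ρ, 0 ≤ g p) :
    ∀ᵐ z ∂(iidLaw ρ), Tendsto (fun n : ℕ =>
      (∑ i ∈ Finset.range n, ENNReal.ofReal (g (z i))) / n) atTop
      (𝓝 (∫⁻ p, ENNReal.ofReal (g p) ∂ρ)) := by
  have hmp := fun i => measurePreserving_eval_infinitePi (fun _ : ℕ => ρ) i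
  have := strongLaw_nonneg (P := iidLaw ρ) (fun i z => g (z i)) (fun i => by fun_prop)
    (fun i => (hmp i).quasiMeasurePreserving.ae hnn)
    (fun i j hij => (iIndepFun_eval_iidLaw.indepFun hij).comp hg hg)
    (fun i => IdentDistrib.comp ⟨(measurable_pi_apply i).aemeasurable,
      (measurable_pi_apply 0).aemeasurable, by rw [Measure.infinitePi_map_eval, Measure.infinitePi_map_eval]⟩ hg)
  rwa [(hmp 0).lintegral_comp (f := fun p => ENNReal.ofReal (g p)) (by fun_prop)] at this

/-- Consecutive products share a cycle and need not be independent, but products whose indices have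
the same parity use disjoint pairs of cycles. The strong law holds along each parity. -/
theorem ae_tendsto_average_consecutive (hρ : IsCycleLaw ρ) :
    ∀ᵐ z ∂(iidLaw ρ), Tendsto (fun n : ℕ =>
      (∑ i ∈ Finset.range n, ENNReal.ofReal ((z i).2 * (z (i + 1)).1)) / n) atTop
      (𝓝 (meanDelay ρ * meanLength ρ)) := by
  have hmp := fun i => measurePreserving_eval_infinitePi (fun _ : ℕ => ρ) i
  have hg : Measurable fun p : (ℝ × ℝ) × (ℝ × ℝ) => p.1.2 * p.2.1 := by fun_prop
  have hE : ∀ i : ℕ, ∫⁻ z, ENNReal.ofReal ((z i).2 * (z (i + 1)).1) ∂(iidLaw ρ) =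
      meanDelay ρ * meanLength ρ := by
    intro i
    have h1 : ∀ᵐ z ∂(iidLaw ρ), ENNReal.ofReal ((z i).2 * (z (i + 1)).1) =
        ((fun z : ℕ → ℝ × ℝ => ENNReal.ofReal (z i).2) *
          fun z : ℕ → ℝ × ℝ => ENNReal.ofReal (z (i + 1)).1) z := by
      filter_upwards [(hmp i).quasiMeasurePreserving.ae hρ] with z hz
      exact ENNReal.ofReal_mul hz.2.1
    have h2 : IndepFun (fun z : ℕ → ℝ × ℝ => ENNReal.ofReal (z i).2)
        (fun z : ℕ → ℝ × ℝ => ENNReal.ofReal (z (i + 1)).1) (iidLaw ρ) :=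
      (iIndepFun_eval_iidLaw.indepFun (show i ≠ i + 1 by omega)).comp
        (φ := fun p : ℝ × ℝ => ENNReal.ofReal p.2) (ψ := fun p : ℝ × ℝ => ENNReal.ofReal p.1)
        (by fun_prop) (by fun_prop)
    rw [lintegral_congr_ae h1, lintegral_mul_eq_lintegral_mul_lintegral_of_indepFun (by fun_prop)
      (by fun_prop) h2,
      (hmp i).lintegral_comp (f := fun p => ENNReal.ofReal p.2) (by fun_prop),
      (hmp (i + 1)).lintegral_comp (f := fun p => ENNReal.ofReal p.1) (by fun_prop)]
    rfl
  have main : ∀ a : ℕ, ∀ᵐ z ∂(iidLaw ρ), Tendsto (fun n : ℕ => (∑ k ∈ Finset.range n,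
      ENNReal.ofReal ((z (2 * k + a)).2 * (z (2 * k + a + 1)).1)) / n) atTop
      (𝓝 (meanDelay ρ * meanLength ρ)) := by
    intro a
    rw [← hE (2 * 0 + a)]
    refine strongLaw_nonneg (P := iidLaw ρ) (fun k z => (z (2 * k + a)).2 * (z (2 * k + a + 1)).1)
      (fun i => by fun_prop) (fun k => ?_) (fun i j hij => ?_) (fun i => ?_)
    · filter_upwards [(hmp (2 * k + a)).quasiMeasurePreserving.ae hρ,
        (hmp (2 * k + a + 1)).quasiMeasurePreserving.ae hρ] with z h1 h2
      exact mul_nonneg h1.2.1 h2.1.le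
    · exact (iIndepFun_eval_iidLaw.indepFun_prodMk_prodMk (fun i => by fun_prop) _ _ _ _
        (by omega) (by omega) (by omega) (by omega)).comp hg hg
    · have hpair : IdentDistrib (fun z : ℕ → ℝ × ℝ => (z (2 * i + a), z (2 * i + a + 1)))
          (fun z : ℕ → ℝ × ℝ => (z (2 * 0 + a), z (2 * 0 + a + 1))) (iidLaw ρ) (iidLaw ρ) :=
        ⟨(by fun_prop : Measurable _).aemeasurable, (by fun_prop : Measurable _).aemeasurable, by
          rw [map_eval_pair_iidLaw (by omega), map_eval_pair_iidLaw (by omega)]⟩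
      exact hpair.comp hg
  filter_upwards [main 0, main 1] with z h0 h1
  exact tendsto_average_of_even_odd (f := fun i => ENNReal.ofReal ((z i).2 * (z (i + 1)).1)) h0 h1

theorem meanLength_ne_zero (hρ : IsCycleLaw ρ) : meanLength ρ ≠ 0 := by
  intro h
  rw [meanLength, lintegral_eq_zero_iff (by fun_prop)] at h
  obtain ⟨p, h1, h2⟩ := (h.and hρ).exists
  exact absurd (ENNReal.ofReal_eq_zero.1 h1) (not_le.2 h2.1)

theorem ae_tendsto_timeAverage (hρ : IsCycleLaw ρ) :
    ∀ᵐ z ∂(iidLaw ρ), Tendsto (timeAverage (age (epoch fun i => (z i).1)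
      (stamp (fun i => (z i).1) fun i => (z i).2))) atTop (𝓝 (meanAge ρ)) := by
  have hX := ae_tendsto_average_eval (ρ := ρ) measurable_fst (hρ.mono fun p hp => hp.1.le)
  have hS := ae_tendsto_average_eval (ρ := ρ) (g := fun p => p.1 ^ 2 / 2) (by fun_prop)
    (ae_of_all _ fun p => by positivity)
  filter_upwards [ae_good_fresh hρ, hX, hS, ae_tendsto_average_consecutive hρ] with z hz h1 h2 h3
  obtain ⟨hx, hy⟩ := hz
  -- With infinite mean length both averages in the quotient may diverge, so the limit cannot be
  -- read off from their quotient.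
  by_cases hm : meanLength ρ = ⊤
  · rw [meanAge, if_pos hm]
    refine tendsto_timeAverage_top hx hy ?_
    rw [← hm]
    exact h1
  · rw [meanAge, if_neg hm]
    refine tendsto_timeAverage hx hy (meanLength_ne_zero hρ) hm h1 ?_
    refine ((tendsto_average_lag (f := ENNReal.ofReal) ENNReal.ofReal_zero h3).add h2).congr
      fun n => ?_
    rw [← ENNReal.add_div, ← Finset.sum_add_distrib]
    congr 1
    refine Finset.sum_congr rfl fun i _ => ?_
    have hl := mul_nonneg (hy.lag_nonneg i) (hx.1 i).le
    rw [cycleCost, ENNReal.ofReal_add hl (by positivity)]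
    congr 2
    cases i <;> simp [lag]

theorem ae_tendsto_sequenceAverage (hρ : IsCycleLaw ρ) :
    ∀ᵐ z ∂(iidLaw ρ), Tendsto (sequenceAverage (peakAge (epoch fun i => (z i).1)
      (stamp (fun i => (z i).1) fun i => (z i).2))) atTop (𝓝 (meanLength ρ + meanDelay ρ)) := by
  have hX := ae_tendsto_average_eval (ρ := ρ) measurable_fst (hρ.mono fun p hp => hp.1.le)
  have hY := ae_tendsto_average_eval (ρ := ρ) measurable_snd (hρ.mono fun p hp => hp.2.1)
  filter_upwards [ae_good_fresh hρ, hX, hY] with z hz h1 h2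
  refine (h1.add (tendsto_average_lag (f := ENNReal.ofReal) ENNReal.ofReal_zero h2)).congr
    fun n => ?_
  rw [sequenceAverage, ← ENNReal.add_div, ← Finset.sum_add_distrib]
  congr 1
  refine Finset.sum_congr rfl fun i _ => ?_
  rw [peakAge_epoch_stamp, ENNReal.ofReal_add (hz.1.1 i).le (hz.2.lag_nonneg i)]

theorem tendsto_lintegral_peakAge (hρ : IsCycleLaw ρ) :
    Tendsto (fun l => ∫⁻ z, ENNReal.ofReal (peakAge (epoch fun i => (z i).1)
      (stamp (fun i => (z i).1) fun i => (z i).2) l) ∂(iidLaw ρ)) atTop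
      (𝓝 (meanLength ρ + meanDelay ρ)) := by
  have hmp := fun i => measurePreserving_eval_infinitePi (fun _ : ℕ => ρ) i
  -- The expected peak is constant from index `1` on; only the first peak starts from the artificial
  -- initial age `0`.
  refine tendsto_const_nhds.congr' ((eventually_ge_atTop 1).mono fun l hl => ?_)
  obtain ⟨l, rfl⟩ : ∃ k, l = k + 1 := ⟨l - 1, by omega⟩
  have h1 : ∀ᵐ z ∂(iidLaw ρ), ENNReal.ofReal (peakAge (epoch fun i => (z i).1)
      (stamp (fun i => (z i).1) fun i => (z i).2) (l + 1)) =
      ENNReal.ofReal (z (l + 1)).1 + ENNReal.ofReal (z l).2 := by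
    filter_upwards [ae_good_fresh hρ] with z hz
    rw [peakAge_epoch_stamp, ENNReal.ofReal_add (hz.1.1 _).le (hz.2.lag_nonneg _)]
    rfl
  simp only
  rw [lintegral_congr_ae h1, lintegral_add_left (by fun_prop),
    (hmp (l + 1)).lintegral_comp (f := fun p => ENNReal.ofReal p.1) (by fun_prop),
    (hmp l).lintegral_comp (f := fun p => ENNReal.ofReal p.2) (by fun_prop)]
  rfl

end

/-! ### Sample paths in terms of cycles -/

/-- The arrivals with interarrival times `t` after time `c` have interarrival times `t'`, counted
from time `c` on. -/
def IsResidual (t' t : ℕ → ℝ) (c : ℝ) : Prop :=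
  ∃ m, (∀ k, arr t (m + k) = c + arr t' k) ∧ ∀ i < m, arr t i ≤ c

theorem arr_residual (t : ℕ → ℝ) (u : ℝ) (k : ℕ) :
    arr t (count t u + k) = u + arr (residual t u) k := by
  induction k with
  | zero => simp [arr_zero, residual]
  | succ k ih =>
    rw [← add_assoc, arr_succ, ih, arr_succ]
    simp [residual, add_assoc]

theorem isResidual_residual (t : ℕ → ℝ) (u : ℝ) : IsResidual (residual t u) t u :=
  ⟨count t u, arr_residual t u, fun _ hi => arr_le_of_lt_count hi⟩

theorem Good.residual {t : ℕ → ℝ} (ht : Good t) (u : ℝ) : Good (residual t u) := by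
  constructor
  · intro i
    rcases i with _ | i
    · simpa [VacationQueue.residual] using ht.lt_arr_count u
    · simpa [VacationQueue.residual] using ht.1 _
  · intro s
    obtain ⟨n, hn⟩ := ht.2 (u + s)
    refine ⟨n, ?_⟩
    have h1 := arr_residual t u n
    have h2 := ht.strictMono.monotone (Nat.le_add_left n (count t u))
    linarith

theorem IsResidual.trans {t t' t'' : ℕ → ℝ} {c d : ℝ} (h : IsResidual t' t c)
    (h' : IsResidual t'' t' d) (hd : 0 ≤ d) : IsResidual t'' t (c + d) := by
  obtain ⟨m, h1, h2⟩ := h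
  obtain ⟨m', h1', h2'⟩ := h'
  refine ⟨m + m', fun k => by rw [add_assoc, h1, h1']; ring, fun i hi => ?_⟩
  rcases lt_or_ge i m with hlt | hge
  · linarith [h2 i hlt]
  · obtain ⟨k, rfl⟩ := Nat.exists_eq_add_of_le hge
    rw [h1]
    linarith [h2' k (by omega)]

section

variable {t t' : ℕ → ℝ} {c : ℝ}

theorem IsResidual.exists_of_lt (h : IsResidual t' t c) {n : ℕ} (hn : c < arr t n) :
    ∃ k, arr t n = c + arr t' k := by
  obtain ⟨m, h1, h2⟩ := h
  rcases lt_or_ge n m with hlt | hge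
  · exact absurd hn (not_lt.2 (h2 n hlt))
  · obtain ⟨k, rfl⟩ := Nat.exists_eq_add_of_le hge
    exact ⟨k, h1 k⟩

theorem epoch_nonneg_of_good (ht : Good t) (j : ℕ) : 0 ≤ epoch t j :=
  Finset.sum_nonneg fun i _ => (ht.1 i).le

theorem IsResidual.arrivalIn_iff (h : IsResidual t' t c) (ht : Good t') (j : ℕ) (u : ℝ) :
    ArrivalIn (arr t) (c + epoch t' j) (c + epoch t' j + u) ↔ t' j ≤ u := by
  have hj := epoch_nonneg_of_good ht j
  constructor
  · rintro ⟨n, h1, h2⟩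
    obtain ⟨k, hk⟩ := h.exists_of_lt (show c < arr t n by linarith)
    rw [hk, arr_eq_epoch] at h1 h2
    have h3 : j < k + 1 := ht.epoch_strictMono.lt_iff_lt.1 (by linarith)
    have h4 := ht.epoch_strictMono.monotone (show j + 1 ≤ k + 1 by omega)
    rw [epoch_succ t' j] at h4
    linarith
  · intro hu
    obtain ⟨m, h1, -⟩ := h
    refine ⟨m + j, ?_, ?_⟩ <;> rw [h1, arr_eq_epoch, epoch_succ]
    · linarith [ht.1 j]
    · linarith

theorem IsResidual.nextArrival_eq (h : IsResidual t' t c) (ht : Good t') (j : ℕ) :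
    nextArrival (arr t) (c + epoch t' j) = c + epoch t' (j + 1) := by
  have hj := epoch_nonneg_of_good ht j
  refine IsLeast.csInf_eq ⟨?_, ?_⟩
  · obtain ⟨m, h1, -⟩ := h
    refine ⟨m + j, by rw [h1, arr_eq_epoch], ?_⟩
    rw [h1, arr_eq_epoch]
    linarith [ht.epoch_strictMono (Nat.lt_succ_self j)]
  · rintro x ⟨n, rfl, hn⟩
    obtain ⟨k, hk⟩ := h.exists_of_lt (show c < arr t n by linarith)
    rw [hk, arr_eq_epoch] at hn ⊢
    have h3 : j < k + 1 := ht.epoch_strictMono.lt_iff_lt.1 (by linarith)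
    linarith [ht.epoch_strictMono.monotone (show j + 1 ≤ k + 1 by omega)]

theorem IsResidual.attemptStart_eq (h : IsResidual t' t c) (ht : Good t') (j : ℕ) :
    attemptStart (arr t) c j = c + epoch t' j := by
  induction j with
  | zero => simp [attemptStart, epoch]
  | succ j ih => rw [attemptStart, ih, h.nextArrival_eq ht]

theorem IsResidual.preemptions_eq (h : IsResidual t' t c) (ht : Good t') (s : ℕ → ℝ) :
    preemptions (arr t) s c = sInf {j | s j < t' j} := by
  simp only [preemptions, h.attemptStart_eq ht, h.arrivalIn_iff ht, not_le]

theorem IsResidual.lastAttemptStart_eq (h : IsResidual t' t c) (ht : Good t') (s : ℕ → ℝ) :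
    lastAttemptStart (arr t) s c = c + (cbspService (t', s)).2 := by
  rw [lastAttemptStart, h.preemptions_eq ht, h.attemptStart_eq ht]
  rfl

theorem IsResidual.resumeTime_eq (h : IsResidual t' t c) (ht : Good t') (v : ℕ → ℝ) :
    resumeTime (arr t) v c = c + resume (t', v) := by
  have h1 : ∀ j, vacationEnd v c j = c + vacationEnd v 0 j := fun j => by simp [vacationEnd]
  have h2 : ∀ u, ArrivalIn (arr t) c (c + u) ↔ t' 0 ≤ u := fun u => by
    simpa [epoch] using h.arrivalIn_iff ht 0 u
  rw [ht.resume_eq, resumeTime]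
  simp only [h1, h2]

/-- By `hu` some arrival falls in `(c, c + u]`, so the arrivals up to time `c` do not compete for
the maximum. -/
theorem IsResidual.lastArrival_eq (h : IsResidual t' t c) (ht : Good t') {u : ℝ} (hu : t' 0 ≤ u) :
    lastArrival (arr t) (c + u) = c + lastArr t' u := by
  have hc := ht.count_pos hu
  have hmem := ht.lastArr_mem hu
  refine IsGreatest.csSup_eq ⟨?_, ?_⟩
  · obtain ⟨m, h1, -⟩ := h
    have h2 : arr t (m + (count t' u - 1)) = c + lastArr t' u := by
      rw [h1, lastArr, if_neg hc.ne']
    exact ⟨_, h2.symm, by rw [h2]; linarith⟩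
  · rintro x ⟨n, rfl, hn⟩
    by_cases hcn : c < arr t n
    · obtain ⟨k, hk⟩ := h.exists_of_lt hcn
      rw [hk] at hn ⊢
      have h3 : k < count t' u := ht.lt_count_iff.2 (by linarith)
      have h4 := ht.strictMono.monotone (show k ≤ count t' u - 1 by omega)
      rw [lastArr, if_neg hc.ne']
      linarith
    · linarith

theorem IsResidual.lastArrival_epoch (h : IsResidual t' t c) (j : ℕ) :
    lastArrival (arr t) (c + epoch t' (j + 1)) = c + epoch t' (j + 1) := by
  refine IsGreatest.csSup_eq ⟨?_, ?_⟩
  · obtain ⟨m, h1, -⟩ := h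
    exact ⟨m + j, by rw [h1, arr_eq_epoch], by rw [h1, arr_eq_epoch]⟩
  · rintro x ⟨n, rfl, hn⟩
    exact hn

end

/-- The length of a cycle, and the age at its end of the packet completed then. -/
def cyclePair (o : (ℝ × ℝ) × (ℝ × ℝ)) : ℝ × ℝ :=
  (o.1.1 + o.2.1, o.1.1 + o.2.1 - if 0 < o.2.2 then o.1.1 + o.2.2 else o.1.2)

/-- The length of a cycle, and the age at its end of the packet that was put in service first. -/
def boundPair (o : (ℝ × ℝ) × (ℝ × ℝ)) : ℝ × ℝ := (o.1.1 + o.2.1, o.1.1 + o.2.1 - o.1.2)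

/-- The lengths of the cycles, and the ages of the packets completed at their ends. -/
def cyclePairs (σ : (ℕ → ℝ) × (ℕ → ℝ) → ℝ × ℝ) (e : Input) (n : ℕ) : ℝ × ℝ :=
  cyclePair (cycles σ e n)

/-- The system never runs into a degenerate situation. -/
def GoodInput (σ : (ℕ → ℝ) × (ℕ → ℝ) → ℝ × ℝ) (e : Input) : Prop :=
  ∀ n, (Good ((nextInput σ)^[n] e).1 ∧ GoodVacations (((nextInput σ)^[n] e).2.1 0)) ∧
    0 ≤ (cycles σ e n).2.1

theorem iterate_nextInput_snd (σ : (ℕ → ℝ) × (ℕ → ℝ) → ℝ × ℝ) (e : Input) (n : ℕ) :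
    ((nextInput σ)^[n] e).2 = (fun l => e.2.1 (l + n), fun l => e.2.2 (l + n)) := by
  induction n with
  | zero => rfl
  | succ n ih =>
    rw [Function.iterate_succ_apply', nextInput, ih]
    simp only [Nat.add_assoc, Nat.add_comm 1]

/-- The recursions are assumed only when the arrivals after `C l` are those seen by cycle `l`. The
induction carries this along with the value of `C l`, since two successive residuals form the
residual at the next completion. -/
theorem eq_epoch_stamp {σ : (ℕ → ℝ) × (ℕ → ℝ) → ℝ × ℝ} {e : Input} (he : GoodInput σ e)
    {C r : ℕ → ℝ} (hC0 : C 0 = 0) (hr0 : r 0 = 0)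
    (hC : ∀ l, IsResidual ((nextInput σ)^[l] e).1 e.1 (C l) →
      C (l + 1) = C l + (cyclePairs σ e l).1)
    (hr : ∀ l, IsResidual ((nextInput σ)^[l] e).1 e.1 (C l) →
      r (l + 1) = C l + ((cyclePairs σ e l).1 - (cyclePairs σ e l).2)) :
    C = epoch (fun i => (cyclePairs σ e i).1) ∧
      r = stamp (fun i => (cyclePairs σ e i).1) (fun i => (cyclePairs σ e i).2) := by
  have key : ∀ l, IsResidual ((nextInput σ)^[l] e).1 e.1 (C l) ∧
      C l = epoch (fun i => (cyclePairs σ e i).1) l := by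
    intro l
    induction l with
    | zero => exact ⟨⟨0, fun k => by simp [hC0], fun i hi => absurd hi (Nat.not_lt_zero i)⟩,
        by simp [hC0, epoch]⟩
    | succ l ih =>
      obtain ⟨⟨hg, hv⟩, hD⟩ := he l
      have hR : 0 ≤ resume (((nextInput σ)^[l] e).1, ((nextInput σ)^[l] e).2.1 0) :=
        (hg.1 0).le.trans (hg.le_resume hv)
      refine ⟨?_, by rw [hC l ih.1, ih.2, epoch_succ]⟩
      rw [Function.iterate_succ_apply', hC l ih.1]
      have := (ih.1.trans (isResidual_residual _ _) hR).trans (isResidual_residual _ _) hD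
      rw [add_assoc] at this
      exact this
  refine ⟨funext fun l => (key l).2, funext fun l => ?_⟩
  rcases l with _ | l
  · simp [hr0, stamp, epoch, lag]
  · rw [hr l (key l).1, (key l).2, stamp, epoch_succ]
    simp only [lag]
    ring

theorem cbs_eq_epoch_stamp {e : Input} (he : GoodInput cbsService e) :
    cbsCompletion (arr e.1) e.2.2 e.2.1 = epoch (fun i => (cyclePairs cbsService e i).1) ∧
    cbsGeneration (arr e.1) e.2.2 e.2.1 = stamp (fun i => (cyclePairs cbsService e i).1)
      (fun i => (cyclePairs cbsService e i).2) := by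
  refine eq_epoch_stamp he rfl rfl (fun l hl => ?_) (fun l hl => ?_)
  all_goals
    obtain ⟨⟨hg, hv⟩, -⟩ := he l
    have h2 := iterate_nextInput_snd cbsService e l
    have hv0 : e.2.1 l = ((nextInput cbsService)^[l] e).2.1 0 := by simp [h2]
    have hh0 : e.2.2 l = ((nextInput cbsService)^[l] e).2.2 0 := by simp [h2]
  · rw [cbsCompletion, hl.resumeTime_eq hg, hv0, hh0, add_assoc]
    rfl
  · rw [cbsGeneration, hl.resumeTime_eq hg, hv0, hl.lastArrival_eq hg (hg.le_resume hv)]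
    simp [cyclePairs, cycles, cyclePair, cycle, cbsService, idlePhase]

theorem cbsp_eq_epoch_stamp {e : Input} (he : GoodInput cbspService e) :
    cbspCompletion (arr e.1) e.2.2 e.2.1 = epoch (fun i => (cyclePairs cbspService e i).1) ∧
    cbspGeneration (arr e.1) e.2.2 e.2.1 = stamp (fun i => (cyclePairs cbspService e i).1)
      (fun i => (cyclePairs cbspService e i).2) := by
  refine eq_epoch_stamp he rfl rfl (fun l hl => ?_) (fun l hl => ?_)
  all_goals
    obtain ⟨⟨hg, hv⟩, -⟩ := he l
    have h2 := iterate_nextInput_snd cbspService e l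
    have hv0 : e.2.1 l = ((nextInput cbspService)^[l] e).2.1 0 := by simp [h2]
    have hh0 : e.2.2 l = ((nextInput cbspService)^[l] e).2.2 0 := by simp [h2]
    have hR := hg.le_resume hv
    have hg' := hg.residual (resume (((nextInput cbspService)^[l] e).1,
      ((nextInput cbspService)^[l] e).2.1 0))
    have hl' := hl.trans (isResidual_residual _ _) ((hg.1 0).le.trans hR)
  · rw [cbspCompletion]
    simp only [hl.resumeTime_eq hg, hv0, hh0, hl'.lastAttemptStart_eq hg', hl'.preemptions_eq hg']
    simp only [cyclePairs, cycles, cyclePair, cycle, cbspService, idlePhase]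
    ring
  · rw [cbspGeneration]
    simp only [hl.resumeTime_eq hg, hv0, hh0, hl'.lastAttemptStart_eq hg']
    set t'' := residual ((nextInput cbspService)^[l] e).1
      (resume (((nextInput cbspService)^[l] e).1, ((nextInput cbspService)^[l] e).2.1 0))
    set s := ((nextInput cbspService)^[l] e).2.2 0
    have hY : (cyclePairs cbspService e l).1 - (cyclePairs cbspService e l).2 =
        if 0 < (cbspService (t'', s)).2 then
          resume (((nextInput cbspService)^[l] e).1, ((nextInput cbspService)^[l] e).2.1 0) +
            (cbspService (t'', s)).2
        else lastArr ((nextInput cbspService)^[l] e).1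
          (resume (((nextInput cbspService)^[l] e).1, ((nextInput cbspService)^[l] e).2.1 0)) :=
      sub_sub_cancel _ _
    rw [hY]
    have hB : (cbspService (t'', s)).2 = epoch t'' (sInf {j | s j < t'' j}) := rfl
    -- Without preemption the completed packet is the one in the buffer at the resume time;
    -- otherwise it was generated when its service started. The sign of the last preemption time
    -- tells the cases apart.
    rcases hN : sInf {j | s j < t'' j} with _ | N
    · rw [hN] at hB
      have h0 : (cbspService (t'', s)).2 = 0 := by simpa [epoch] using hB
      rw [h0, add_zero, if_neg (lt_irrefl _), hl.lastArrival_eq hg hR]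
    · rw [hN] at hB
      have hpos : 0 < (cbspService (t'', s)).2 := by
        rw [hB]
        exact hg'.arr_pos N
      rw [if_pos hpos, hB, hl'.lastArrival_epoch]
      ring

/-! ### Comparison of the two systems -/

theorem measurable_cyclePair : Measurable cyclePair := by
  unfold cyclePair
  refine Measurable.prodMk (by fun_prop) (Measurable.sub (by fun_prop) ?_)
  exact Measurable.ite (measurableSet_lt (by fun_prop) (by fun_prop)) (by fun_prop) (by fun_prop)

theorem measurable_boundPair : Measurable boundPair := by
  unfold boundPair
  fun_prop

section

variable {lam mu : ℝ} {ν : Measure ℝ} {σ : (ℕ → ℝ) × (ℕ → ℝ) → ℝ × ℝ}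

/-- The joint law of the length of a cycle and the age of the packet completed at its end. -/
abbrev cycleLaw (lam mu : ℝ) (ν : Measure ℝ) (σ : (ℕ → ℝ) × (ℕ → ℝ) → ℝ × ℝ) : Measure (ℝ × ℝ) :=
  ((idleLaw lam ν).prod (serviceLaw lam mu σ)).map cyclePair

theorem measurableSet_bounds :
    MeasurableSet {p : ℝ × ℝ | 0 < p.1 ∧ 0 ≤ p.2 ∧ p.2 ≤ p.1} :=
  (measurableSet_lt measurable_const measurable_fst).inter
    ((measurableSet_le measurable_const measurable_snd).inter
      (measurableSet_le measurable_snd measurable_fst))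

theorem ae_bounds_cycle (hlam : 0 < lam) (hmu : 0 < mu) [IsProbabilityMeasure ν]
    (hν : ν (Set.Iio 0) = 0) (hν0 : ν (Set.Ioi 0) ≠ 0) (hσ : IsService lam mu σ) :
    ∀ᵐ o ∂((idleLaw lam ν).prod (serviceLaw lam mu σ)),
      (0 < o.1.2 ∧ o.1.2 ≤ o.1.1) ∧ 0 < o.2.1 ∧ 0 ≤ o.2.2 ∧ o.2.2 ≤ o.2.1 := by
  have := isProbabilityMeasure_expMeasure hlam
  have := isProbabilityMeasure_expMeasure hmu
  have := isProbabilityMeasure_idleLaw (ν := ν) hlam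
  have := isProbabilityMeasure_serviceLaw hlam hmu hσ
  have h1 : ∀ᵐ o ∂(idleLaw lam ν), 0 < o.2 ∧ o.2 ≤ o.1 := by
    refine (ae_map_iff measurable_idlePhase.aemeasurable
      ((measurableSet_lt measurable_const measurable_snd).inter
        (measurableSet_le measurable_snd measurable_fst))).2 ?_
    filter_upwards [Measure.quasiMeasurePreserving_fst.ae (ae_good hlam),
      Measure.quasiMeasurePreserving_snd.ae (ae_goodVacations ν hν hν0)] with p hp hv
    exact hp.lastArr_mem (hp.le_resume hv)
  have h2 : ∀ᵐ o ∂(serviceLaw lam mu σ), 0 < o.1 ∧ 0 ≤ o.2 ∧ o.2 ≤ o.1 :=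
    (ae_map_iff hσ.measurable.aemeasurable measurableSet_bounds).2 hσ.ae_bounds
  exact (Measure.quasiMeasurePreserving_fst.ae h1).and (Measure.quasiMeasurePreserving_snd.ae h2)

theorem isCycleLaw_cycleLaw (hlam : 0 < lam) (hmu : 0 < mu) [IsProbabilityMeasure ν]
    (hν : ν (Set.Iio 0) = 0) (hν0 : ν (Set.Ioi 0) ≠ 0) (hσ : IsService lam mu σ) :
    IsCycleLaw (cycleLaw lam mu ν σ) := by
  refine (ae_map_iff measurable_cyclePair.aemeasurable measurableSet_bounds).2 ?_
  filter_upwards [ae_bounds_cycle hlam hmu hν hν0 hσ] with o ho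
  obtain ⟨⟨h1, h2⟩, h3, h4, h5⟩ := ho
  simp only [cyclePair]
  split_ifs <;> refine ⟨?_, ?_, ?_⟩ <;> linarith

theorem measurePreserving_cyclePairs (hlam : 0 < lam) (hmu : 0 < mu) [IsProbabilityMeasure ν]
    (hν : ν (Set.Iio 0) = 0) (hν0 : ν (Set.Ioi 0) ≠ 0) (hσ : IsService lam mu σ)
    {f : (ℝ × ℝ) × (ℝ × ℝ) → ℝ × ℝ} (hf : Measurable f) :
    MeasurePreserving (fun e n => f (cycles σ e n)) (inputLaw lam mu ν)
      (iidLaw (((idleLaw lam ν).prod (serviceLaw lam mu σ)).map f)) := by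
  have := isProbabilityMeasure_idleLaw (ν := ν) hlam
  have := isProbabilityMeasure_serviceLaw hlam hmu hσ
  have h : MeasurePreserving (fun (z : ℕ → (ℝ × ℝ) × (ℝ × ℝ)) n => f (z n))
      (iidLaw ((idleLaw lam ν).prod (serviceLaw lam mu σ)))
      (iidLaw (((idleLaw lam ν).prod (serviceLaw lam mu σ)).map f)) :=
    ⟨by fun_prop, Measure.infinitePi_map_pi
      (fun _ : ℕ => (idleLaw lam ν).prod (serviceLaw lam mu σ)) fun _ => hf⟩
  exact h.comp (measurePreserving_cycles hlam hmu hν hν0 hσ)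

theorem ae_goodInput (hlam : 0 < lam) (hmu : 0 < mu) [IsProbabilityMeasure ν]
    (hν : ν (Set.Iio 0) = 0) (hν0 : ν (Set.Ioi 0) ≠ 0) (hσ : IsService lam mu σ) :
    ∀ᵐ e ∂(inputLaw lam mu ν), GoodInput σ e := by
  have := isProbabilityMeasure_expMeasure hlam
  have := isProbabilityMeasure_expMeasure hmu
  have := isProbabilityMeasure_idleLaw (ν := ν) hlam
  have := isProbabilityMeasure_serviceLaw hlam hmu hσ
  have hvac : ∀ᵐ w ∂((iidLaw (iidLaw ν)).prod (iidLaw (iidLaw (expMeasure mu)))),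
      GoodVacations (w.1 0) :=
    Measure.quasiMeasurePreserving_fst.ae
      ((measurePreserving_eval_infinitePi (fun _ : ℕ => iidLaw ν) 0).quasiMeasurePreserving.ae
        (ae_goodVacations ν hν hν0))
  have h1 : ∀ᵐ e ∂(inputLaw lam mu ν), Good e.1 ∧ GoodVacations (e.2.1 0) :=
    (Measure.quasiMeasurePreserving_fst.ae (ae_good hlam)).and
      (Measure.quasiMeasurePreserving_snd.ae hvac)
  have h2 : ∀ᵐ e ∂(inputLaw lam mu ν), 0 ≤ (cycle σ e).2.1 := by
    have hc := (measurePreserving_fst.comp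
      (measurePreserving_cycle_nextInput hlam hmu ν hν hν0 hσ)).quasiMeasurePreserving.ae
        (ae_bounds_cycle hlam hmu hν hν0 hσ)
    exact hc.mono fun e he => he.2.1.le
  exact ae_orbit (measurePreserving_nextInput hlam hmu hν hν0 hσ) (h1.and h2)

/-- The law of `boundPair` does not depend on the service discipline. -/
theorem map_boundPair (hlam : 0 < lam) (hmu : 0 < mu) [IsProbabilityMeasure ν]
    (hσ : IsService lam mu σ) :
    ((idleLaw lam ν).prod (serviceLaw lam mu σ)).map boundPair =
      ((idleLaw lam ν).prod (expMeasure mu)).map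
        fun p => (p.1.1 + p.2, p.1.1 + p.2 - p.1.2) := by
  have := isProbabilityMeasure_expMeasure hmu
  have := isProbabilityMeasure_idleLaw (ν := ν) hlam
  have := isProbabilityMeasure_serviceLaw hlam hmu hσ
  have h : MeasurePreserving Prod.fst (serviceLaw lam mu σ) (expMeasure mu) :=
    ⟨measurable_fst, by
      rw [Measure.map_map measurable_fst hσ.measurable]
      exact hσ.law_duration⟩
  rw [← ((MeasurePreserving.id (idleLaw lam ν)).prod h).map_eq,
    Measure.map_map (by fun_prop) (by fun_prop)]
  rfl

/-- Without preemption the first packet in service is the one completed. -/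
theorem map_boundPair_cbs (hlam : 0 < lam) (hmu : 0 < mu) [IsProbabilityMeasure ν] :
    ((idleLaw lam ν).prod (serviceLaw lam mu cbsService)).map boundPair =
      cycleLaw lam mu ν cbsService := by
  have := isProbabilityMeasure_expMeasure hlam
  have := isProbabilityMeasure_expMeasure hmu
  have hσ := isService_cbsService hlam hmu
  have := isProbabilityMeasure_idleLaw (ν := ν) hlam
  have := isProbabilityMeasure_serviceLaw hlam hmu hσ
  have h : ∀ᵐ o ∂(serviceLaw lam mu cbsService), o.2 = 0 :=
    (ae_map_iff hσ.measurable.aemeasurable (measurableSet_eq_fun (by fun_prop) (by fun_prop))).2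
      (ae_of_all _ fun p => rfl)
  refine Measure.map_congr ?_
  filter_upwards [Measure.quasiMeasurePreserving_snd.ae h] with o ho
  simp [boundPair, cyclePair, ho]

/-- A preempting packet is generated after the resume time, the first packet in service no later
than it. -/
theorem cyclePair_le_boundPair {o : (ℝ × ℝ) × (ℝ × ℝ)} (h : o.1.2 ≤ o.1.1) :
    (cyclePair o).2 ≤ (boundPair o).2 := by
  simp only [cyclePair, boundPair]
  split_ifs <;> linarith

/-- The CBS cycle law is the law of `boundPair` under `σ`. Lengths thus have equal laws, delays can
only shrink, and both limits increase with the mean delay. -/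
theorem means_le (hlam : 0 < lam) (hmu : 0 < mu) [IsProbabilityMeasure ν]
    (hν : ν (Set.Iio 0) = 0) (hν0 : ν (Set.Ioi 0) ≠ 0) (hσ : IsService lam mu σ) :
    meanAge (cycleLaw lam mu ν σ) ≤ meanAge (cycleLaw lam mu ν cbsService) ∧
    meanLength (cycleLaw lam mu ν σ) + meanDelay (cycleLaw lam mu ν σ) ≤
      meanLength (cycleLaw lam mu ν cbsService) + meanDelay (cycleLaw lam mu ν cbsService) := by
  have heq : cycleLaw lam mu ν cbsService =
      ((idleLaw lam ν).prod (serviceLaw lam mu σ)).map boundPair := by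
    rw [← map_boundPair_cbs hlam hmu, map_boundPair hlam hmu (isService_cbsService hlam hmu),
      map_boundPair hlam hmu hσ]
  have hfst : ∀ g : ℝ → ℝ≥0∞, Measurable g →
      ∫⁻ p, g p.1 ∂(cycleLaw lam mu ν σ) = ∫⁻ p, g p.1 ∂(cycleLaw lam mu ν cbsService) := by
    intro g hg
    rw [heq, lintegral_map (by fun_prop) measurable_cyclePair,
      lintegral_map (by fun_prop) measurable_boundPair]
    rfl
  have hL : meanLength (cycleLaw lam mu ν σ) = meanLength (cycleLaw lam mu ν cbsService) :=
    hfst ENNReal.ofReal ENNReal.measurable_ofReal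
  have hS := hfst (fun x => ENNReal.ofReal (x ^ 2 / 2)) (by fun_prop)
  have hD : meanDelay (cycleLaw lam mu ν σ) ≤ meanDelay (cycleLaw lam mu ν cbsService) := by
    rw [heq, meanDelay, meanDelay, lintegral_map (by fun_prop) measurable_cyclePair,
      lintegral_map (by fun_prop) measurable_boundPair]
    refine lintegral_mono_ae ?_
    filter_upwards [ae_bounds_cycle hlam hmu hν hν0 hσ] with o ho
    exact ENNReal.ofReal_le_ofReal (cyclePair_le_boundPair ho.1.2)
  constructor
  · simp only [meanAge, hL, hS]
    split_ifs
    · exact le_rfl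
    · gcongr
  · rw [hL]
    gcongr

/-- The age and its peaks in a system with the service discipline `σ`, in terms of its cycles. -/
theorem limits_of_cycles (hlam : 0 < lam) (hmu : 0 < mu) [IsProbabilityMeasure ν]
    (hν : ν (Set.Iio 0) = 0) (hν0 : ν (Set.Ioi 0) ≠ 0) (hσ : IsService lam mu σ)
    {Ω : Type*} [MeasurableSpace Ω] {P : Measure Ω} {e : Ω → Input}
    (he : MeasurePreserving e P (inputLaw lam mu ν)) {C r : Ω → ℕ → ℝ}
    (hCr : ∀ᵐ ω ∂P, C ω = epoch (fun i => (cyclePairs σ (e ω) i).1) ∧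
      r ω = stamp (fun i => (cyclePairs σ (e ω) i).1) (fun i => (cyclePairs σ (e ω) i).2)) :
    IsTimeAverageAge P (fun t ω => age (C ω) (r ω) t) (meanAge (cycleLaw lam mu ν σ)) ∧
    IsPeakAge P (fun l ω => peakAge (C ω) (r ω) l)
      (meanLength (cycleLaw lam mu ν σ) + meanDelay (cycleLaw lam mu ν σ)) ∧
    ∀ t, 0 ≤ t → ∫⁻ ω, ENNReal.ofReal (age (C ω) (r ω) t) ∂P = ∫⁻ ω, ENNReal.ofReal
      (cycleAge (fun i => (cyclePairs σ (e ω) i).1) (fun i => (cyclePairs σ (e ω) i).2) t) ∂P := by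
  have := isProbabilityMeasure_idleLaw (ν := ν) hlam
  have := isProbabilityMeasure_serviceLaw hlam hmu hσ
  have hprob : IsProbabilityMeasure (cycleLaw lam mu ν σ) :=
    Measure.isProbabilityMeasure_map measurable_cyclePair.aemeasurable
  have hcl := isCycleLaw_cycleLaw hlam hmu hν hν0 hσ
  have hmp : MeasurePreserving (fun ω => cyclePairs σ (e ω)) P (iidLaw (cycleLaw lam mu ν σ)) :=
    (measurePreserving_cyclePairs hlam hmu hν hν0 hσ measurable_cyclePair).comp he
  refine ⟨?_, ⟨?_, ?_⟩, fun t ht => ?_⟩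
  · filter_upwards [hCr, hmp.quasiMeasurePreserving.ae (ae_tendsto_timeAverage hcl)] with ω h1 h2
    rw [h1.1, h1.2]
    exact h2
  · filter_upwards [hCr, hmp.quasiMeasurePreserving.ae (ae_tendsto_sequenceAverage hcl)]
      with ω h1 h2
    rw [h1.1, h1.2]
    exact h2
  · refine (tendsto_lintegral_peakAge hcl).congr fun l => ?_
    have hm : Measurable fun z : ℕ → ℝ × ℝ => ENNReal.ofReal (peakAge (epoch fun i => (z i).1)
        (stamp (fun i => (z i).1) fun i => (z i).2) l) := by
      simp only [peakAge_epoch_stamp]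
      cases l <;> simp only [lag] <;> fun_prop
    rw [← hmp.lintegral_comp hm]
    refine lintegral_congr_ae (hCr.mono fun ω h => ?_)
    simp only [h.1, h.2]
  · refine lintegral_congr_ae ?_
    filter_upwards [hCr, hmp.quasiMeasurePreserving.ae (ae_good_fresh hcl)] with ω h1 h2
    rw [h1.1, h1.2, age_eq_cycleAge h2.1 h2.2 ht]

theorem lintegral_cycleAge_le (hlam : 0 < lam) (hmu : 0 < mu) [IsProbabilityMeasure ν]
    (hν : ν (Set.Iio 0) = 0) (hν0 : ν (Set.Ioi 0) ≠ 0) (hσ : IsService lam mu σ)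
    {Ω : Type*} [MeasurableSpace Ω] {P : Measure Ω} {e : Ω → Input}
    (he : MeasurePreserving e P (inputLaw lam mu ν)) (t : ℝ) :
    ∫⁻ ω, ENNReal.ofReal (cycleAge (fun i => (cyclePairs σ (e ω) i).1)
      (fun i => (cyclePairs σ (e ω) i).2) t) ∂P ≤
    ∫⁻ ω, ENNReal.ofReal (cycleAge (fun i => (cyclePairs cbsService (e ω) i).1)
      (fun i => (cyclePairs cbsService (e ω) i).2) t) ∂P := by
  have hcbs := isService_cbsService hlam hmu
  have := isProbabilityMeasure_idleLaw (ν := ν) hlam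
  have := isProbabilityMeasure_serviceLaw hlam hmu hσ
  have hm : Measurable fun z : ℕ → ℝ × ℝ =>
      ENNReal.ofReal (cycleAge (fun i => (z i).1) (fun i => (z i).2) t) :=
    ((measurable_cycleAge t).comp (by fun_prop : Measurable fun z : ℕ → ℝ × ℝ =>
      ((fun i => (z i).1), fun i => (z i).2))).ennreal_ofReal
  have h1 := (measurePreserving_cyclePairs hlam hmu hν hν0 hcbs measurable_cyclePair).comp he
  have h2 := (measurePreserving_cyclePairs hlam hmu hν hν0 hσ measurable_boundPair).comp he
  -- The sequence of bound pairs under `σ` now has the law of the CBS cycle sequence, so it replaces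
  -- CBS in a pathwise comparison.
  rw [map_boundPair hlam hmu hσ, ← map_boundPair hlam hmu hcbs, map_boundPair_cbs hlam hmu] at h2
  have hall := he.quasiMeasurePreserving.ae
    ((measurePreserving_cycles hlam hmu hν hν0 hσ).quasiMeasurePreserving.ae
      (ae_all_iff.2 fun i => (measurePreserving_eval_infinitePi (fun _ : ℕ =>
        (idleLaw lam ν).prod (serviceLaw lam mu σ)) i).quasiMeasurePreserving.ae
          (ae_bounds_cycle hlam hmu hν hν0 hσ)))
  refine le_trans (lintegral_mono_ae ?_) ((h2.lintegral_comp hm).trans (h1.lintegral_comp hm).symm).le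
  filter_upwards [hall] with ω h
  refine ENNReal.ofReal_le_ofReal (add_le_add_left ?_ _)
  change lag _ (count (fun i => (cyclePairs σ (e ω) i).1) t) ≤
    lag _ (count (fun i => (cyclePairs σ (e ω) i).1) t)
  -- The number of completed cycles depends on the lengths only, which both sequences share, so just
  -- the age at the last completion differs.
  rcases count (fun i => (cyclePairs σ (e ω) i).1) t with _ | n
  · exact le_rfl
  · exact cyclePair_le_boundPair (h n).1.2

end

end

end VacationQueue

/-! ### The comparison theorem for the model. -/

theorem mainTheorem5 {Ω : Type*} [MeasurableSpace Ω] (P : Measure Ω) [IsProbabilityMeasure P]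
    (lam mu : ℝ) (hlam : 0 < lam) (hmu : 0 < mu)
    (ν : Measure ℝ) [IsProbabilityMeasure ν] (hν : ν (Set.Iio 0) = 0) (hν0 : ν (Set.Ioi 0) ≠ 0)
    (T : ℕ → Ω → ℝ) (H V : ℕ × ℕ → Ω → ℝ)
    (hmodel : VacationQueue.IsModel P lam mu ν T H V) :
    (∃ aC aP : ℝ≥0∞,
      VacationQueue.IsTimeAverageAge P (VacationQueue.cbsAge T H V) aC ∧
      VacationQueue.IsTimeAverageAge P (VacationQueue.cbspAge T H V) aP ∧
      aP ≤ aC) ∧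
    (∀ dC dP : ℝ≥0∞,
      VacationQueue.IsLimitExpectedAge P (VacationQueue.cbsAge T H V) dC →
      VacationQueue.IsLimitExpectedAge P (VacationQueue.cbspAge T H V) dP →
      dP ≤ dC) ∧
    (∃ pC pP : ℝ≥0∞,
      VacationQueue.IsPeakAge P (VacationQueue.cbsPeak T H V) pC ∧
      VacationQueue.IsPeakAge P (VacationQueue.cbspPeak T H V) pP ∧
      pP ≤ pC) := by
  have he := VacationQueue.measurePreserving_modelInput hlam hmu hmodel
  have hC := VacationQueue.isService_cbsService hlam hmu
  have hP := VacationQueue.isService_cbspService hlam hmu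
  obtain ⟨tC, pC, eC⟩ := VacationQueue.limits_of_cycles hlam hmu hν hν0 hC he
    ((he.quasiMeasurePreserving.ae (VacationQueue.ae_goodInput hlam hmu hν hν0 hC)).mono
      fun ω h => VacationQueue.cbs_eq_epoch_stamp h)
  obtain ⟨tP, pP, eP⟩ := VacationQueue.limits_of_cycles hlam hmu hν hν0 hP he
    ((he.quasiMeasurePreserving.ae (VacationQueue.ae_goodInput hlam hmu hν hν0 hP)).mono
      fun ω h => VacationQueue.cbsp_eq_epoch_stamp h)
  obtain ⟨hage, hpeak⟩ := VacationQueue.means_le hlam hmu hν hν0 hP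
  refine ⟨⟨_, _, tC, tP, hage⟩, fun dC dP hdC hdP => ?_, ⟨_, _, pC, pP, hpeak⟩⟩
  refine le_of_tendsto_of_tendsto hdP hdC ((eventually_ge_atTop 0).mono fun t ht => ?_)
  exact ((eP t ht).trans_le
    (VacationQueue.lintegral_cycleAge_le hlam hmu hν hν0 hP he t)).trans (eC t ht).ge
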